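/- **Theorem (partial derivatives of $\ln\sigma$ with respect to the periods).** Let $\omega_1,\omega_2\in\mathbb{C}$ be linearly independent over $\mathbb{R}$ with $\operatorname{Im}(\omega_2/\omega_1)>0$, let $\Lambda=\{m_1\omega_1+m_2\omega_2 : m_1,m_2\in\mathbb{Z}\}$, and let $$\wp(z)=\frac1{z^2}+\sum_{\omega\in\Lambda\setminus\{0\}}\Bigl[\frac1{(z-\omega)^2}-\frac1{\omega^2}\Bigr],\qquad \zeta(z)=\zeta(z;\omega_1,\omega_2)=\frac1z+\sum_{\omega\in\Lambda\setminus\{0\}}\Bigl[\frac1{z-\omega}+\frac1\omega+\frac z{\omega^2}\Bigr],$$ $$\sigma(z)=\sigma(z;\omega_1,\omega_2)=z\prod_{\omega\in\Lambda\setminus\{0\}}\Bigl(1-\frac z\omega\Bigr)e^{\frac z\omega+\frac{z^2}{2\omega^2}},\qquad g_2=60\sum_{\omega\in\Lambda\setminus\{0\}}\frac1{\omega^4},\qquad \eta_k=2\,\zeta(\omega_k/2)\quad(k=1,2).$$ Let $z\in\mathbb{C}\setminus\Lambda$. Then near $(z,\omega_1,\omega_2)$ there is a continuous branch of $\ln\sigma(z;\omega_1,\omega_2)$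 as a function of the three complex variables, and every such branch has at this point the complex partial derivatives with respect to the periods $$\frac{\partial\ln\sigma(z)}{\partial\omega_1}=\frac1{2\pi i}\Bigl[\tfrac12\,\omega_2\bigl(\wp(z)-\zeta(z)^2\bigr)+\eta_2\bigl(z\zeta(z)-1\bigr)-\omega_2\frac{g_2}{24}\,z^2\Bigr],$$ $$\frac{\partial\ln\sigma(z)}{\partial\omega_2}=-\frac1{2\pi i}\Bigl[\tfrac12\,\omega_1\bigl(\wp(z)-\zeta(z)^2\bigr)+\eta_1\bigl(z\zeta(z)-1\bigr)-\omega_1\frac{g_2}{24}\,z^2\Bigr].$$ -/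

import Mathlib

open scoped Topology

noncomputable section

namespace EllipticPeriods

/-- The index set of the primed sums and products: all pairs of integers `(m₁, m₂) ≠ (0, 0)`. -/
abbrev NonzeroPair : Type := {m : ℤ × ℤ // m ≠ 0}

/-- The period `ω = m₁ ω₁ + m₂ ω₂` with index `m = (m₁, m₂)`. -/
def period (ω₁ ω₂ : ℂ) (m : ℤ × ℤ) : ℂ := (m.1 : ℂ) * ω₁ + (m.2 : ℂ) * ω₂

/-- The Weierstrass zeta function
`ζ(z; ω₁, ω₂) = 1/z + ∑' [1/(z - ω) + 1/ω + z/ω²]`, as a function of `z` and of both periods. -/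
def weierstrassZeta (z ω₁ ω₂ : ℂ) : ℂ :=
  1 / z + ∑' m : NonzeroPair,
    (1 / (z - period ω₁ ω₂ m) + 1 / period ω₁ ω₂ m + z / period ω₁ ω₂ m ^ 2)

/-- The Weierstrass sigma function
`σ(z; ω₁, ω₂) = z ∏' (1 - z/ω) exp(z/ω + z²/(2ω²))`, as a function of `z` and of both periods. -/
def weierstrassSigma (z ω₁ ω₂ : ℂ) : ℂ :=
  z * ∏' m : NonzeroPair,
    ((1 - z / period ω₁ ω₂ m) *
      Complex.exp (z / period ω₁ ω₂ m + z ^ 2 / (2 * period ω₁ ω₂ m ^ 2)))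

/-- `η₁ = 2 ζ(ω₁/2; ω₁, ω₂)`. -/
def eta₁ (ω₁ ω₂ : ℂ) : ℂ := 2 * weierstrassZeta (ω₁ / 2) ω₁ ω₂

/-- `η₂ = 2 ζ(ω₂/2; ω₁, ω₂)`. -/
def eta₂ (ω₁ ω₂ : ℂ) : ℂ := 2 * weierstrassZeta (ω₂ / 2) ω₁ ω₂

/-- `ℓ` is, near the point `p = (z, ω₁, ω₂)`, a continuous branch of `ln σ(z; ω₁, ω₂)` as a
function of the three complex variables. -/
def IsLogSigmaBranch (ℓ : ℂ × ℂ × ℂ → ℂ) (p : ℂ × ℂ × ℂ) : Prop :=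
  ∀ᶠ q in 𝓝 p, ContinuousAt ℓ q ∧ Complex.exp (ℓ q) = weierstrassSigma q.1 q.2.1 q.2.2

end EllipticPeriods

end

namespace EllipticPeriods

open Filter Complex

/-! Differentiating the product for `σ` logarithmically in the direction `(v₁, v₂)` gives the series
`∑' p z³ / (ω³ (ω - z))` with `p = m₁ v₁ + m₂ v₂` (`hasDerivAt_weierstrassSigma_line`). For `(1, 0)`
this is `S₁ = periodSum`, and the claim for `ω₁` is `2πi S₁ = R` with `R = periodForm`.

Put `κ = η₁ ω₂ - η₂ ω₁`. Under `z ↦ z + ω₁` both `κ S₁` and `R` change by `-κ ζ` plus a polynomial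
of degree at most two; under `z ↦ z + ω₂` both change by such a polynomial only. Three derivatives
kill the polynomials, so `(κ S₁ - R)'''` is elliptic. At the origin `κ S₁ - R` is `O(z³)`, the `z²`
terms cancelling because `g₂ / 24 = 5 G₄ / 2`. Hence the third derivative has no poles and is
constant; it is odd, so it is zero, and an `O(z³)` function with zero third derivative vanishes
(`defect_eq_zero`). Legendre's relation `κ = 2πi` (`legendre_eq`) gives the first formula.

The second follows from homogeneity, `σ(λz; λω₁, λω₂) = λ σ(z; ω₁, ω₂)`: Euler's relation `zζ + ω₁
∂₁ ln σ + ω₂ ∂₂ ln σ = 1` (`tsum_period_two`) determines `∂₂` from `∂₁`. The passage from `σ` to an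
arbitrary continuous branch of `ln σ` is `hasDerivAt_of_exp_eq`. -/

/-! ### Lower bounds for periods and summability over the lattice -/

lemma period_eq_zero_iff (L : PeriodPair) (m : ℤ × ℤ) : period L.ω₁ L.ω₂ m = 0 ↔ m = 0 := by
  constructor
  · intro h
    have h' := LinearIndependent.pair_iff.mp L.indep (m.1 : ℝ) (m.2 : ℝ)
      (by simpa [period] using h)
    exact Prod.ext (by exact_mod_cast h'.1) (by exact_mod_cast h'.2)
  · rintro rfl
    simp [period]

lemma period_add_smul (ω₁ ω₂ v₁ v₂ t : ℂ) (m : ℤ × ℤ) :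
    period (ω₁ + t * v₁) (ω₂ + t * v₂) m = period ω₁ ω₂ m + t * period v₁ v₂ m := by
  simp only [period]
  ring

lemma norm_period_le (v₁ v₂ : ℂ) (m : ℤ × ℤ) :
    ‖period v₁ v₂ m‖ ≤ (‖v₁‖ + ‖v₂‖) * ‖m‖ := by
  have h1 : ‖(m.1 : ℂ)‖ ≤ ‖m‖ := by
    rw [Complex.norm_intCast, ← Int.norm_eq_abs]; exact norm_fst_le m
  have h2 : ‖(m.2 : ℂ)‖ ≤ ‖m‖ := by
    rw [Complex.norm_intCast, ← Int.norm_eq_abs]; exact norm_snd_le m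
  calc ‖period v₁ v₂ m‖ ≤ ‖(m.1 : ℂ) * v₁‖ + ‖(m.2 : ℂ) * v₂‖ := norm_add_le _ _
    _ ≤ ‖m‖ * ‖v₁‖ + ‖m‖ * ‖v₂‖ := by
      rw [norm_mul, norm_mul]; gcongr
    _ = _ := by ring

/-- An injective real-linear map from a finite-dimensional space is bounded below. -/
lemma exists_le_norm_period (L : PeriodPair) :
    ∃ c > 0, ∀ m : ℤ × ℤ, c * ‖m‖ ≤ ‖period L.ω₁ L.ω₂ m‖ := by
  obtain ⟨K, hK, h⟩ := (L.basis.equivFun.symm.toLinearMap).exists_antilipschitzWith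
    (LinearMap.ker_eq_bot.mpr L.basis.equivFun.symm.injective)
  refine ⟨(K : ℝ)⁻¹, by positivity, fun m ↦ ?_⟩
  have := h.le_mul_dist ![(m.1 : ℝ), (m.2 : ℝ)] 0
  simp only [dist_zero_right, LinearEquiv.coe_coe, map_zero, Module.Basis.equivFun_symm_apply,
    Fin.sum_univ_two, PeriodPair.basis_zero, PeriodPair.basis_one] at this
  rw [inv_mul_le_iff₀ (by positivity)]
  have hm : ‖m‖ ≤ ‖![(m.1 : ℝ), (m.2 : ℝ)]‖ := by
    rw [Prod.norm_def]
    refine max_le ?_ ?_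
    · simpa [Int.norm_eq_abs] using norm_le_pi_norm ![(m.1 : ℝ), (m.2 : ℝ)] 0
    · simpa [Int.norm_eq_abs] using norm_le_pi_norm ![(m.1 : ℝ), (m.2 : ℝ)] 1
  refine hm.trans (this.trans_eq ?_)
  simp [period]

/-- The bound of a period from below by its index is uniform in the pair of periods. -/
lemma exists_eventually_le_norm_period (L : PeriodPair) :
    ∃ c > 0, ∀ᶠ q : ℂ × ℂ in 𝓝 (L.ω₁, L.ω₂), ∀ m : ℤ × ℤ, c * ‖m‖ ≤ ‖period q.1 q.2 m‖ := by
  obtain ⟨c, hc, h⟩ := exists_le_norm_period L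
  refine ⟨c / 2, by positivity, ?_⟩
  filter_upwards [Metric.ball_mem_nhds (L.ω₁, L.ω₂) (show 0 < c / 4 by positivity)] with q hq m
  rw [mem_ball_iff_norm, Prod.norm_def, max_lt_iff] at hq
  have h1 : period L.ω₁ L.ω₂ m = period q.1 q.2 m - period (q.1 - L.ω₁) (q.2 - L.ω₂) m := by
    simp only [period]; ring
  have h2 := norm_period_le (q.1 - L.ω₁) (q.2 - L.ω₂) m
  have h3 := h m
  rw [h1] at h3
  have h4 := norm_sub_le (period q.1 q.2 m) (period (q.1 - L.ω₁) (q.2 - L.ω₂) m)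
  have h5 : (‖q.1 - L.ω₁‖ + ‖q.2 - L.ω₂‖) * ‖m‖ ≤ (c / 4 + c / 4) * ‖m‖ := by
    gcongr
    exacts [hq.1.le, hq.2.le]
  linarith

lemma one_le_norm_index (m : NonzeroPair) : 1 ≤ ‖m.1‖ := by
  obtain ⟨⟨a, b⟩, h⟩ := m
  rw [Prod.norm_def, le_max_iff]
  simp only [Int.norm_eq_abs]
  by_contra! h'
  obtain ⟨h1, h2⟩ := h'
  refine h (Prod.ext ?_ ?_)
  · exact Int.abs_lt_one_iff.mp (by exact_mod_cast h1)
  · exact Int.abs_lt_one_iff.mp (by exact_mod_cast h2)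

lemma summable_inv_norm_index_cube : Summable fun m : NonzeroPair ↦ (‖m.1‖ ^ 3)⁻¹ := by
  have h := EisensteinSeries.summable_one_div_norm_rpow (k := 3) (by norm_num)
  rw [← (finTwoArrowEquiv ℤ).symm.summable_iff] at h
  refine (h.subtype {m | m ≠ 0}).congr fun m ↦ ?_
  simp only [Function.comp_apply, finTwoArrowEquiv_symm_apply]
  have : ‖![m.1.1, m.1.2]‖ = ‖m.1‖ := by
    rw [EisensteinSeries.norm_eq_max_natAbs, Prod.norm_def]
    simp [Int.norm_eq_abs]
  rw [this, Real.rpow_neg (norm_nonneg _)]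
  norm_cast

lemma eventually_cofinite_le_norm_index (R : ℝ) : ∀ᶠ m : NonzeroPair in cofinite, R ≤ ‖m.1‖ := by
  have h : Tendsto (fun m : ℤ × ℤ ↦ ‖m‖) cofinite atTop := by
    rw [← cocompact_eq_cofinite]
    exact tendsto_norm_cocompact_atTop
  exact (h.comp Subtype.val_injective.tendsto_cofinite).eventually_ge_atTop R

/-! ### The product for `σ`: local uniform convergence, continuity, zeros -/

/-- The elementary factor of genus two. -/
noncomputable def elementaryFactor (u : ℂ) : ℂ := (1 - u) * exp (u + u ^ 2 / 2)

/-- The exponent cancels the Taylor polynomial of `log (1 - u)` up to degree two, which leaves a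
cubic remainder. -/
lemma norm_elementaryFactor_sub_one_le {u : ℂ} (hu : ‖u‖ ≤ 1 / 2) :
    ‖elementaryFactor u - 1‖ ≤ 2 * ‖u‖ ^ 3 := by
  have hu1 : ‖-u‖ < 1 := by rw [norm_neg]; linarith
  have h := norm_log_sub_logTaylor_le 2 hu1
  -- `logTaylor n` stops before degree `n`, so index 3 gives the quadratic polynomial.
  have hT : logTaylor 3 (-u) = -(u + u ^ 2 / 2) := by
    simp [logTaylor_succ, logTaylor_zero]
    ring
  rw [show (2 + 1 : ℕ) = 3 from rfl, hT, sub_neg_eq_add, norm_neg, ← sub_eq_add_neg] at h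
  have hne : 1 - u ≠ 0 := by
    intro h0
    have : u = 1 := by linear_combination -h0
    rw [this] at hu
    norm_num at hu
  have hE : elementaryFactor u = exp (log (1 - u) + (u + u ^ 2 / 2)) := by
    rw [exp_add, exp_log hne, elementaryFactor]
  have hb : ‖log (1 - u) + (u + u ^ 2 / 2)‖ ≤ ‖u‖ ^ 3 := by
    refine h.trans ?_
    have : (1 - ‖u‖)⁻¹ ≤ 2 := by
      rw [inv_le_comm₀ (by linarith) (by norm_num)]
      linarith
    rw [div_le_iff₀ (by norm_num)]
    push_cast
    have h3 : 0 ≤ ‖u‖ ^ 3 := by positivity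
    nlinarith
  have h1 : ‖u‖ ^ 3 ≤ 1 := pow_le_one₀ (norm_nonneg _) (by linarith)
  rw [hE]
  refine (norm_exp_sub_one_le (hb.trans h1)).trans ?_
  gcongr

lemma elementaryFactor_ne_zero {u : ℂ} (hu : u ≠ 1) : elementaryFactor u ≠ 0 :=
  mul_ne_zero (sub_ne_zero.mpr hu.symm) (exp_ne_zero _)

lemma differentiable_elementaryFactor : Differentiable ℂ elementaryFactor := by
  unfold elementaryFactor
  fun_prop

lemma logDeriv_elementaryFactor {u : ℂ} (hu : u ≠ 1) :
    logDeriv elementaryFactor u = -u ^ 2 / (1 - u) := by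
  have h1 : 1 - u ≠ 0 := sub_ne_zero.mpr hu.symm
  have hd : HasDerivAt elementaryFactor
      ((0 - 1) * exp (u + u ^ 2 / 2) +
        (1 - u) * (exp (u + u ^ 2 / 2) * (1 + ((2 : ℕ) * u ^ (2 - 1) * 1) / 2))) u :=
    ((hasDerivAt_const u (1 : ℂ)).sub (hasDerivAt_id u)).mul
      ((hasDerivAt_id u).add (((hasDerivAt_id u).pow 2).div_const 2)).cexp
  rw [logDeriv_apply, hd.deriv, elementaryFactor]
  have := exp_ne_zero (u + u ^ 2 / 2)
  field_simp
  norm_num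
  ring

lemma weierstrassSigma_eq (z ω₁ ω₂ : ℂ) : weierstrassSigma z ω₁ ω₂ =
    z * ∏' m : NonzeroPair, (1 + (elementaryFactor (z / period ω₁ ω₂ m) - 1)) := by
  simp only [weierstrassSigma, elementaryFactor, add_sub_cancel]
  congr! 6
  rw [div_pow, div_div, mul_comm]

/-- Near a lattice, the product of the sigma function is dominated by a convergent series. -/
lemma exists_nhds_norm_elementaryFactor_le (L : PeriodPair) (z : ℂ) :
    ∃ K : Set (ℂ × ℂ × ℂ), IsOpen K ∧ (z, L.ω₁, L.ω₂) ∈ K ∧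
      (∀ q ∈ K, ∀ m : NonzeroPair, period q.2.1 q.2.2 m ≠ 0) ∧
      ∃ C : ℝ, ∀ᶠ m : NonzeroPair in cofinite, ∀ q ∈ K,
        ‖elementaryFactor (q.1 / period q.2.1 q.2.2 m) - 1‖ ≤ C * (‖m.1‖ ^ 3)⁻¹ := by
  obtain ⟨c, hc, h⟩ := exists_eventually_le_norm_period L
  obtain ⟨V, hV, hVo, hVm⟩ := eventually_nhds_iff.mp h
  set r : ℝ := ‖z‖ + 1 with hr
  have hr0 : 0 < r := by positivity
  refine ⟨Metric.ball 0 r ×ˢ V, Metric.isOpen_ball.prod hVo, ⟨by simp [hr], hVm⟩, ?_,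
    2 * (r / c) ^ 3, ?_⟩
  · rintro q ⟨-, hq⟩ m hm
    have := hV q.2 hq m
    rw [hm, norm_zero] at this
    have := one_le_norm_index m
    nlinarith
  -- Beyond the index norm `2 r / c` the argument of the elementary factor has norm at most `1 / 2`.
  · filter_upwards [eventually_cofinite_le_norm_index (2 * r / c)] with m hm q hq
    obtain ⟨hq1, hq2⟩ := hq
    rw [mem_ball_zero_iff] at hq1
    have h1 := one_le_norm_index m
    have h2 := hV q.2 hq2 m
    have hb : ‖q.1 / period q.2.1 q.2.2 m‖ ≤ r / c * ‖m.1‖⁻¹ := by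
      rw [norm_div]
      calc ‖q.1‖ / ‖period q.2.1 q.2.2 m‖ ≤ r / (c * ‖m.1‖) := by gcongr
        _ = _ := by field_simp
    have hb2 : r / c * ‖m.1‖⁻¹ ≤ 1 / 2 := by
      rw [← div_eq_mul_inv, div_le_iff₀ (by linarith)]
      rw [mul_div_assoc] at hm
      linarith
    refine (norm_elementaryFactor_sub_one_le (hb.trans hb2)).trans ?_
    calc 2 * ‖q.1 / period q.2.1 q.2.2 m‖ ^ 3 ≤ 2 * (r / c * ‖m.1‖⁻¹) ^ 3 := by gcongr
      _ = _ := by rw [mul_pow, inv_pow]; ring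

lemma continuous_period (m : ℤ × ℤ) :
    Continuous fun q : ℂ × ℂ × ℂ ↦ period q.2.1 q.2.2 m := by
  unfold period
  fun_prop

lemma continuousOn_elementaryFactor {K : Set (ℂ × ℂ × ℂ)} (m : ℤ × ℤ)
    (hK : ∀ q ∈ K, period q.2.1 q.2.2 m ≠ 0) :
    ContinuousOn (fun q : ℂ × ℂ × ℂ ↦ elementaryFactor (q.1 / period q.2.1 q.2.2 m) - 1) K :=
  (differentiable_elementaryFactor.continuous.comp_continuousOn
    (continuous_fst.continuousOn.div (continuous_period m).continuousOn hK)).sub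
    continuousOn_const

lemma eventually_continuousAt_weierstrassSigma (L : PeriodPair) (z : ℂ) :
    ∀ᶠ q in 𝓝 (z, L.ω₁, L.ω₂),
      ContinuousAt (fun q : ℂ × ℂ × ℂ ↦ weierstrassSigma q.1 q.2.1 q.2.2) q := by
  obtain ⟨K, hKo, hzK, hne, C, hC⟩ := exists_nhds_norm_elementaryFactor_le L z
  have hcts := fun m : NonzeroPair ↦ continuousOn_elementaryFactor m.1 (hne · · m)
  have hP := Summable.hasProdLocallyUniformlyOn_one_add hKo
    (summable_inv_norm_index_cube.mul_left C) hC hcts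
  rw [hasProdLocallyUniformlyOn_iff_tendstoLocallyUniformlyOn] at hP
  have hcont := hP.continuousOn (Eventually.of_forall fun s ↦
    continuousOn_finsetProd s fun m _ ↦ continuousOn_const.add (hcts m)).frequently
  filter_upwards [hKo.mem_nhds hzK] with q hq
  have hq' : ContinuousAt (fun q : ℂ × ℂ × ℂ ↦ ∏' m : NonzeroPair,
      (1 + (elementaryFactor (q.1 / period q.2.1 q.2.2 m) - 1))) q :=
    hcont.continuousAt (hKo.mem_nhds hq)
  have hfst : ContinuousAt (fun q : ℂ × ℂ × ℂ ↦ q.1) q := continuousAt_fst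
  exact (hfst.mul hq').congr (Eventually.of_forall fun q ↦ (weierstrassSigma_eq _ _ _).symm)

lemma period_mem_lattice (L : PeriodPair) (m : ℤ × ℤ) : period L.ω₁ L.ω₂ m ∈ L.lattice :=
  PeriodPair.mem_lattice.mpr ⟨m.1, m.2, rfl⟩

lemma tprod_elementaryFactor_ne_zero (L : PeriodPair) {z : ℂ} (hz : z ∉ L.lattice) :
    ∏' m : NonzeroPair, (1 + (elementaryFactor (z / period L.ω₁ L.ω₂ m) - 1)) ≠ 0 := by
  obtain ⟨K, hKo, hzK, hne, C, hC⟩ := exists_nhds_norm_elementaryFactor_le L z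
  refine tprod_one_add_ne_zero_of_summable (fun m ↦ ?_) ?_
  · rw [add_sub_cancel]
    refine elementaryFactor_ne_zero fun h ↦ hz ?_
    rw [div_eq_one_iff_eq (hne (z, L.ω₁, L.ω₂) hzK m)] at h
    exact h ▸ period_mem_lattice L m
  · refine (summable_inv_norm_index_cube.mul_left C).of_norm_bounded_eventually ?_
    filter_upwards [hC] with m hm
    rw [norm_norm]
    exact hm (z, L.ω₁, L.ω₂) hzK

lemma weierstrassSigma_ne_zero (L : PeriodPair) {z : ℂ} (hz : z ∉ L.lattice) :
    weierstrassSigma z L.ω₁ L.ω₂ ≠ 0 := by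
  rw [weierstrassSigma_eq]
  refine mul_ne_zero ?_ (tprod_elementaryFactor_ne_zero L hz)
  rintro rfl
  exact hz (zero_mem _)

/-! ### The derivative of `ln σ` in the periods as a series -/

/-- The summands of the derivative of `ln σ` with respect to the periods are dominated by a
convergent series. -/
lemma exists_norm_period_mul_le (L : PeriodPair) (v₁ v₂ : ℂ) (r : ℝ) :
    ∃ C : ℝ, ∀ᶠ m : NonzeroPair in cofinite, ∀ z : ℂ, ‖z‖ < r →
      ‖period v₁ v₂ m * z ^ 3 / (period L.ω₁ L.ω₂ m ^ 3 * (period L.ω₁ L.ω₂ m - z))‖ ≤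
        C * (‖m.1‖ ^ 3)⁻¹ := by
  obtain ⟨c, hc, h⟩ := exists_le_norm_period L
  refine ⟨(‖v₁‖ + ‖v₂‖) * r ^ 3 * (2 / c ^ 4), ?_⟩
  filter_upwards [eventually_cofinite_le_norm_index (2 * r / c)] with m hm z hz
  have h1 := one_le_norm_index m
  have h2 := h m
  have h3 := norm_period_le v₁ v₂ m
  rw [div_le_iff₀ hc] at hm
  have hr : 0 < r := (norm_nonneg z).trans_lt hz
  have h4 : c * ‖m.1‖ / 2 ≤ ‖period L.ω₁ L.ω₂ m - z‖ := by
    have := norm_sub_norm_le (period L.ω₁ L.ω₂ m) z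
    linarith
  rw [norm_div, norm_mul, norm_mul, norm_pow, norm_pow]
  have h5 : 0 < ‖m.1‖ := by linarith
  calc ‖period v₁ v₂ m‖ * ‖z‖ ^ 3 / (‖period L.ω₁ L.ω₂ m‖ ^ 3 * ‖period L.ω₁ L.ω₂ m - z‖)
      ≤ ((‖v₁‖ + ‖v₂‖) * ‖m.1‖) * r ^ 3 / ((c * ‖m.1‖) ^ 3 * (c * ‖m.1‖ / 2)) := by gcongr
    _ = _ := by field_simp

lemma summable_period_mul (L : PeriodPair) (v₁ v₂ z : ℂ) : Summable fun m : NonzeroPair ↦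
    period v₁ v₂ m * z ^ 3 / (period L.ω₁ L.ω₂ m ^ 3 * (period L.ω₁ L.ω₂ m - z)) := by
  obtain ⟨C, hC⟩ := exists_norm_period_mul_le L v₁ v₂ (‖z‖ + 1)
  refine (summable_inv_norm_index_cube.mul_left C).of_norm_bounded_eventually ?_
  filter_upwards [hC] with m hm
  exact hm z (lt_add_one _)

lemma logDeriv_elementaryFactor_line (L : PeriodPair) {z : ℂ} (hz : z ∉ L.lattice)
    (v₁ v₂ : ℂ) (m : NonzeroPair) :
    logDeriv (fun t : ℂ ↦ 1 + (elementaryFactor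
      (z / period (L.ω₁ + t * v₁) (L.ω₂ + t * v₂) m) - 1)) 0 =
    period v₁ v₂ m * z ^ 3 / (period L.ω₁ L.ω₂ m ^ 3 * (period L.ω₁ L.ω₂ m - z)) := by
  have hω : period L.ω₁ L.ω₂ m ≠ 0 := (period_eq_zero_iff L m.1).not.mpr m.2
  have hωz : period L.ω₁ L.ω₂ m - z ≠ 0 := fun h ↦
    hz (sub_eq_zero.mp h ▸ period_mem_lattice L m)
  have hu : z / period L.ω₁ L.ω₂ m ≠ 1 := fun h ↦
    hωz (by rw [div_eq_one_iff_eq hω] at h; rw [h, sub_self])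
  simp only [add_sub_cancel, period_add_smul]
  set ω := period L.ω₁ L.ω₂ m
  set p := period v₁ v₂ m
  have hg : HasDerivAt (fun t : ℂ ↦ z / (ω + t * p)) (-(z * p) / ω ^ 2) 0 := by
    have h1 : HasDerivAt (fun t : ℂ ↦ ω + t * p) p 0 := by
      simpa using ((hasDerivAt_id (0 : ℂ)).mul_const p).const_add ω
    have h2 := (hasDerivAt_const (0 : ℂ) z).div h1 (by simpa using hω)
    simpa [Pi.div_def] using h2
  have hu' : z / (ω + 0 * p) ≠ 1 := by simpa using hu
  have := logDeriv_comp (f := elementaryFactor) (g := fun t : ℂ ↦ z / (ω + t * p)) (x := 0)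
    (differentiable_elementaryFactor _) hg.differentiableAt
  rw [Function.comp_def] at this
  rw [this, logDeriv_elementaryFactor hu', hg.deriv, zero_mul, add_zero]
  have h1 : 1 - z / ω ≠ 0 := sub_ne_zero.mpr hu.symm
  have h2 : 1 - z / ω = (ω - z) / ω := by field_simp
  rw [h2]
  field_simp

/-- The logarithmic derivative of the sigma function in the direction `(v₁, v₂)` of the space of
pairs of periods. -/
lemma hasDerivAt_weierstrassSigma_line (L : PeriodPair) {z : ℂ} (hz : z ∉ L.lattice)
    (v₁ v₂ : ℂ) :
    HasDerivAt (fun t : ℂ ↦ weierstrassSigma z (L.ω₁ + t * v₁) (L.ω₂ + t * v₂))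
      (weierstrassSigma z L.ω₁ L.ω₂ * ∑' m : NonzeroPair,
        period v₁ v₂ m * z ^ 3 / (period L.ω₁ L.ω₂ m ^ 3 * (period L.ω₁ L.ω₂ m - z))) 0 := by
  obtain ⟨K, hKo, hzK, hne, C, hC⟩ := exists_nhds_norm_elementaryFactor_le L z
  let γ : ℂ → ℂ × ℂ × ℂ := fun t ↦ (z, L.ω₁ + t * v₁, L.ω₂ + t * v₂)
  have hγ : Continuous γ := by fun_prop
  have hSo : IsOpen (γ ⁻¹' K) := hKo.preimage hγ
  have h0 : (0 : ℂ) ∈ γ ⁻¹' K := by simpa [γ] using hzK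
  let f : NonzeroPair → ℂ → ℂ := fun m t ↦
    elementaryFactor (z / period (L.ω₁ + t * v₁) (L.ω₂ + t * v₂) m) - 1
  have hd : ∀ m, DifferentiableOn ℂ (fun t ↦ f m t) (γ ⁻¹' K) := fun m ↦ by
    refine (differentiable_elementaryFactor.comp_differentiableOn ?_).sub_const 1
    refine (differentiableOn_const z).div ?_ fun t ht ↦ hne (γ t) ht m
    unfold period
    fun_prop
  have hC' : ∀ᶠ m in cofinite, ∀ t ∈ γ ⁻¹' K, ‖f m t‖ ≤ C * (‖m.1‖ ^ 3)⁻¹ := by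
    filter_upwards [hC] with m hm t ht
    exact hm (γ t) ht
  have hM := Summable.multipliableLocallyUniformlyOn_one_add hSo
    (summable_inv_norm_index_cube.mul_left C) hC' fun m ↦ (hd m).continuousOn
  have hP0 : ∏' m, (1 + f m 0) ≠ 0 := by
    simpa [f] using tprod_elementaryFactor_ne_zero L hz
  have hf0 : ∀ m, 1 + f m 0 ≠ 0 := fun m ↦ by
    simp only [f, add_sub_cancel, zero_mul, add_zero]
    refine elementaryFactor_ne_zero fun h ↦ hz ?_
    rw [div_eq_one_iff_eq (hne (z, L.ω₁, L.ω₂) hzK m)] at h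
    exact h ▸ period_mem_lattice L m
  -- The logarithmic derivative of a locally uniformly convergent product of holomorphic functions
  -- of `t` is taken factor by factor.
  have hlog := logDeriv_tprod_eq_tsum hSo h0 hf0 (fun m ↦ (hd m).const_add 1)
    ((summable_period_mul L v₁ v₂ z).congr fun m ↦
      (logDeriv_elementaryFactor_line L hz v₁ v₂ m).symm) hM hP0
  rw [tsum_congr fun m ↦ logDeriv_elementaryFactor_line L hz v₁ v₂ m] at hlog
  have hdiff : DifferentiableAt ℂ (fun t ↦ ∏' m, (1 + f m t)) 0 := by
    have hP := hM.hasProdLocallyUniformlyOn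
    rw [hasProdLocallyUniformlyOn_iff_tendstoLocallyUniformlyOn] at hP
    refine (hP.differentiableOn (Eventually.of_forall fun s ↦ ?_) hSo).differentiableAt
      (hSo.mem_nhds h0)
    exact DifferentiableOn.fun_finsetProd fun m _ ↦ (hd m).const_add 1
  rw [logDeriv_apply, div_eq_iff hP0] at hlog
  have := hdiff.hasDerivAt.const_mul z
  rw [hlog] at this
  refine (this.congr_deriv ?_).congr_of_eventuallyEq
    (Eventually.of_forall fun t ↦ weierstrassSigma_eq _ _ _)
  rw [weierstrassSigma_eq]
  simp only [f, zero_mul, add_zero]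
  ring

/-! ### Termwise differentiation of lattice series -/

/-- The open set of points that are not nonzero lattice points. -/
def regularSet (L : PeriodPair) : Set ℂ := ((L.lattice : Set ℂ) \ {0})ᶜ

lemma isOpen_regularSet (L : PeriodPair) : IsOpen (regularSet L) :=
  L.isOpen_compl_lattice_sdiff

lemma zero_mem_regularSet (L : PeriodPair) : (0 : ℂ) ∈ regularSet L := by
  simp [regularSet]

lemma compl_lattice_subset_regularSet (L : PeriodPair) :
    ((L.lattice : Set ℂ))ᶜ ⊆ regularSet L :=
  Set.compl_subset_compl.mpr Set.sdiff_subset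

lemma period_ne_zero (L : PeriodPair) (m : NonzeroPair) : period L.ω₁ L.ω₂ m ≠ 0 :=
  (period_eq_zero_iff L m.1).not.mpr m.2

lemma ne_period_of_mem_regularSet {L : PeriodPair} {z : ℂ} (hz : z ∈ regularSet L)
    (m : NonzeroPair) : z ≠ period L.ω₁ L.ω₂ m := by
  rintro rfl
  exact hz ⟨period_mem_lattice L m, period_ne_zero L m⟩

section Termwise

variable {F : NonzeroPair → ℂ → ℂ} {U : Set ℂ}

/-- By Weierstrass's theorem, applied once per derivative. Holomorphy of the derivatives is carried
through the induction because each application needs it. -/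
lemma _root_.TendstoLocallyUniformlyOn.iteratedDeriv {ι : Type*} {φ : Filter ι} {F : ι → ℂ → ℂ}
    {f : ℂ → ℂ} (hf : TendstoLocallyUniformlyOn F f φ U)
    (hF : ∀ᶠ n in φ, DifferentiableOn ℂ (F n) U) (hU : IsOpen U) (j : ℕ) :
    TendstoLocallyUniformlyOn (fun n ↦ iteratedDeriv j (F n)) (iteratedDeriv j f) φ U ∧
      ∀ᶠ n in φ, DifferentiableOn ℂ (iteratedDeriv j (F n)) U := by
  induction j with
  | zero => simpa using ⟨hf, hF⟩
  | succ j ih =>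
    simp only [iteratedDeriv_succ]
    refine ⟨ih.1.deriv ih.2 hU, ?_⟩
    filter_upwards [ih.2] with n hn using hn.deriv hU

lemma tendstoLocallyUniformlyOn_tsum_of_index_bound
    (hF : ∀ r : ℝ, ∃ C : ℝ, ∀ᶠ m : NonzeroPair in cofinite, ∀ z : ℂ, ‖z‖ < r →
      ‖F m z‖ ≤ C * (‖m.1‖ ^ 3)⁻¹) :
    TendstoLocallyUniformlyOn (fun s : Finset NonzeroPair ↦ fun z ↦ ∑ m ∈ s, F m z)
      (fun z ↦ ∑' m, F m z) atTop U := by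
  refine TendstoLocallyUniformly.tendstoLocallyUniformlyOn ?_
  rw [tendstoLocallyUniformly_iff_forall_isCompact]
  intro K hK
  obtain ⟨r, hr⟩ := hK.isBounded.subset_ball 0
  obtain ⟨C, hC⟩ := hF r
  refine tendstoUniformlyOn_tsum_of_cofinite_eventually
    (summable_inv_norm_index_cube.mul_left C) ?_
  filter_upwards [hC] with m hm z hz using hm z (by simpa using hr hz)

lemma differentiableOn_tsum_of_index_bound (hU : IsOpen U)
    (hd : ∀ m, DifferentiableOn ℂ (F m) U)
    (hF : ∀ r : ℝ, ∃ C : ℝ, ∀ᶠ m : NonzeroPair in cofinite, ∀ z : ℂ, ‖z‖ < r →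
      ‖F m z‖ ≤ C * (‖m.1‖ ^ 3)⁻¹) :
    DifferentiableOn ℂ (fun z ↦ ∑' m, F m z) U :=
  (tendstoLocallyUniformlyOn_tsum_of_index_bound hF).differentiableOn
    (Eventually.of_forall fun _ ↦ DifferentiableOn.fun_sum fun m _ ↦ hd m) hU

lemma hasSum_iteratedDeriv_of_index_bound (hU : IsOpen U)
    (hd : ∀ m, DifferentiableOn ℂ (F m) U)
    (hF : ∀ r : ℝ, ∃ C : ℝ, ∀ᶠ m : NonzeroPair in cofinite, ∀ z : ℂ, ‖z‖ < r →
      ‖F m z‖ ≤ C * (‖m.1‖ ^ 3)⁻¹) (j : ℕ) {z : ℂ} (hz : z ∈ U) :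
    HasSum (fun m ↦ iteratedDeriv j (F m) z) (iteratedDeriv j (fun z ↦ ∑' m, F m z) z) := by
  have h := ((tendstoLocallyUniformlyOn_tsum_of_index_bound (U := U) hF).iteratedDeriv
    (Eventually.of_forall fun s ↦ DifferentiableOn.fun_sum fun m _ ↦ hd m) hU j).1.tendsto_at hz
  refine h.congr fun s ↦ ?_
  exact iteratedDeriv_fun_sum fun m _ ↦ ((hd m).analyticAt (hU.mem_nhds hz)).contDiffAt

end Termwise

/-! ### Derivatives of simple fractions with polynomial corrections -/

section PolarPart

variable (a b c d ω : ℂ)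

/-- A simple fraction with a quadratic correction. -/
noncomputable def polarPart (z : ℂ) : ℂ := a / (ω - z) + b + c * z + d * z ^ 2

variable {ω} {z : ℂ}

lemma hasDerivAt_div_sub_pow (n : ℕ) (hz : z ≠ ω) :
    HasDerivAt (fun z ↦ a / (ω - z) ^ (n + 1)) ((n + 1) * a / (ω - z) ^ (n + 2)) z := by
  have h0 : ω - z ≠ 0 := sub_ne_zero.mpr hz.symm
  have h1 : HasDerivAt (fun z ↦ ω - z) (-1) z := by
    simpa using (hasDerivAt_id z).const_sub ω
  have h2 := (hasDerivAt_const z a).div (h1.pow (n + 1)) (pow_ne_zero _ h0)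
  simp only [Pi.div_def, Pi.pow_apply] at h2
  refine h2.congr_deriv ?_
  push_cast
  field_simp
  simp
  ring

lemma deriv_polarPart (hz : z ≠ ω) :
    HasDerivAt (polarPart a b c d ω) (a / (ω - z) ^ 2 + c + 2 * d * z) z := by
  have h := (((hasDerivAt_div_sub_pow a 0 hz).add_const b).add
    ((hasDerivAt_id z).const_mul c)).add (((hasDerivAt_id z).pow 2).const_mul d)
  refine (h.congr_deriv ?_).congr_of_eventuallyEq (Eventually.of_forall fun z ↦ ?_)
  · simp
    ring
  · simp [polarPart]

lemma differentiableOn_polarPart {U : Set ℂ} (hU : ∀ z ∈ U, z ≠ ω) :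
    DifferentiableOn ℂ (polarPart a b c d ω) U :=
  fun z hz ↦ (deriv_polarPart a b c d (hU z hz)).differentiableAt.differentiableWithinAt

lemma iteratedDeriv_one_polarPart (hz : z ≠ ω) :
    iteratedDeriv 1 (polarPart a b c d ω) z = a / (ω - z) ^ 2 + c + 2 * d * z := by
  rw [iteratedDeriv_one, (deriv_polarPart a b c d hz).deriv]

lemma iteratedDeriv_two_polarPart (hz : z ≠ ω) :
    iteratedDeriv 2 (polarPart a b c d ω) z = 2 * a / (ω - z) ^ 3 + 2 * d := by
  rw [iteratedDeriv_succ]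
  have h : iteratedDeriv 1 (polarPart a b c d ω) =ᶠ[𝓝 z]
      fun z ↦ a / (ω - z) ^ 2 + c + 2 * d * z := by
    filter_upwards [isOpen_ne.mem_nhds hz] with w hw using iteratedDeriv_one_polarPart a b c d hw
  rw [h.deriv_eq]
  have h := ((hasDerivAt_div_sub_pow a 1 hz).add_const c).add
    ((hasDerivAt_id z).const_mul (2 * d))
  refine (HasDerivAt.deriv ?_)
  refine (h.congr_deriv ?_).congr_of_eventuallyEq (Eventually.of_forall fun z ↦ ?_)
  · norm_num
  · simp

lemma iteratedDeriv_three_polarPart (hz : z ≠ ω) :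
    iteratedDeriv 3 (polarPart a b c d ω) z = 6 * a / (ω - z) ^ 4 := by
  rw [iteratedDeriv_succ]
  have h : iteratedDeriv 2 (polarPart a b c d ω) =ᶠ[𝓝 z]
      fun z ↦ 2 * a / (ω - z) ^ 3 + 2 * d := by
    filter_upwards [isOpen_ne.mem_nhds hz] with w hw using iteratedDeriv_two_polarPart a b c d hw
  rw [h.deriv_eq]
  have h := ((hasDerivAt_div_sub_pow (2 * a) 2 hz).add_const (2 * d))
  refine (h.congr_deriv ?_).deriv
  norm_num
  ring

end PolarPart

/-! ### The zeta function: derivative, quasi-periods, expansion at the origin -/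

section ZetaReg

/-- The regular part at the origin of the Weierstrass zeta function. -/
noncomputable def zetaReg (L : PeriodPair) (z : ℂ) : ℂ :=
  ∑' m : NonzeroPair, (1 / (z - period L.ω₁ L.ω₂ m) + 1 / period L.ω₁ L.ω₂ m
    + z / period L.ω₁ L.ω₂ m ^ 2)

lemma weierstrassZeta_eq (L : PeriodPair) (z : ℂ) :
    weierstrassZeta z L.ω₁ L.ω₂ = 1 / z + zetaReg L z := rfl

lemma zeta_summand_eq_polarPart (z ω : ℂ) :
    1 / (z - ω) + 1 / ω + z / ω ^ 2 = polarPart (-1) (1 / ω) (1 / ω ^ 2) 0 ω z := by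
  rw [polarPart, ← neg_sub ω z, div_neg, neg_div]
  ring

lemma zetaReg_eq (L : PeriodPair) : zetaReg L = fun z ↦ ∑' m : NonzeroPair,
    polarPart (-1) (1 / period L.ω₁ L.ω₂ m) (1 / period L.ω₁ L.ω₂ m ^ 2) 0
      (period L.ω₁ L.ω₂ m) z := by
  funext z
  simp only [zetaReg, zeta_summand_eq_polarPart]

lemma exists_norm_zeta_summand_le (L : PeriodPair) (r : ℝ) :
    ∃ C : ℝ, ∀ᶠ m : NonzeroPair in cofinite, ∀ z : ℂ, ‖z‖ < r →
      ‖polarPart (-1) (1 / period L.ω₁ L.ω₂ m) (1 / period L.ω₁ L.ω₂ m ^ 2) 0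
        (period L.ω₁ L.ω₂ m) z‖ ≤ C * (‖m.1‖ ^ 3)⁻¹ := by
  obtain ⟨c, hc, h⟩ := exists_le_norm_period L
  refine ⟨r ^ 2 * (2 / c ^ 3), ?_⟩
  filter_upwards [eventually_cofinite_le_norm_index (2 * r / c)] with m hm z hz
  have h1 := one_le_norm_index m
  have h2 := h m
  rw [div_le_iff₀ hc] at hm
  have hr : 0 < r := (norm_nonneg z).trans_lt hz
  have h4 : c * ‖m.1‖ / 2 ≤ ‖period L.ω₁ L.ω₂ m - z‖ := by
    have := norm_sub_norm_le (period L.ω₁ L.ω₂ m) z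
    linarith
  have h5 : 0 < ‖m.1‖ := by linarith
  have h6 : period L.ω₁ L.ω₂ m ≠ 0 := period_ne_zero L m
  have h7 : period L.ω₁ L.ω₂ m - z ≠ 0 := by
    rw [← norm_pos_iff]
    have : 0 < c * ‖m.1‖ / 2 := by positivity
    linarith
  have h8 : polarPart (-1) (1 / period L.ω₁ L.ω₂ m) (1 / period L.ω₁ L.ω₂ m ^ 2) 0
      (period L.ω₁ L.ω₂ m) z =
      -(z ^ 2 / (period L.ω₁ L.ω₂ m ^ 2 * (period L.ω₁ L.ω₂ m - z))) := by
    rw [polarPart]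
    field_simp
    ring
  rw [h8, norm_neg, norm_div, norm_mul, norm_pow, norm_pow]
  calc ‖z‖ ^ 2 / (‖period L.ω₁ L.ω₂ m‖ ^ 2 * ‖period L.ω₁ L.ω₂ m - z‖)
      ≤ r ^ 2 / ((c * ‖m.1‖) ^ 2 * (c * ‖m.1‖ / 2)) := by gcongr
    _ = _ := by field_simp

lemma differentiableOn_zetaReg (L : PeriodPair) :
    DifferentiableOn ℂ (zetaReg L) (regularSet L) := by
  rw [zetaReg_eq]
  exact differentiableOn_tsum_of_index_bound (isOpen_regularSet L)
    (fun m ↦ differentiableOn_polarPart _ _ _ _ fun z hz ↦ ne_period_of_mem_regularSet hz m)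
    (exists_norm_zeta_summand_le L)

lemma hasSum_iteratedDeriv_zetaReg (L : PeriodPair) (j : ℕ) {z : ℂ} (hz : z ∈ regularSet L) :
    HasSum (fun m : NonzeroPair ↦ iteratedDeriv j
      (polarPart (-1) (1 / period L.ω₁ L.ω₂ m) (1 / period L.ω₁ L.ω₂ m ^ 2) 0
        (period L.ω₁ L.ω₂ m)) z) (iteratedDeriv j (zetaReg L) z) := by
  rw [zetaReg_eq]
  exact hasSum_iteratedDeriv_of_index_bound (isOpen_regularSet L)
    (fun m ↦ differentiableOn_polarPart _ _ _ _ fun z hz ↦ ne_period_of_mem_regularSet hz m)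
    (exists_norm_zeta_summand_le L) j hz

/-- Negation on the index set. -/
def negIndex : NonzeroPair ≃ NonzeroPair :=
  (Equiv.neg (ℤ × ℤ)).subtypeEquiv fun m ↦ by simp

@[simp] lemma period_negIndex (ω₁ ω₂ : ℂ) (m : NonzeroPair) :
    period ω₁ ω₂ (negIndex m) = -period ω₁ ω₂ m := by
  simp [negIndex, period]
  ring

lemma zetaReg_neg (L : PeriodPair) (z : ℂ) : zetaReg L (-z) = -zetaReg L z := by
  simp only [zetaReg]
  rw [← negIndex.tsum_eq, ← tsum_neg]
  congr! 2 with m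
  rw [period_negIndex, sub_neg_eq_add, neg_add_eq_sub, ← neg_sub z, div_neg, div_neg, neg_sq,
    neg_div]
  ring

/-- Restoring the index 0 makes the sums invariant under reindexing by lattice translations. -/
lemma hasSum_nonzeroPair_iff {g : ℤ × ℤ → ℂ} {s : ℂ} :
    HasSum (fun m : NonzeroPair ↦ g m) s ↔ HasSum g (s + g 0) := by
  have h := Finset.hasSum_compl_iff (f := g) (a := s) {0}
  rw [Finset.sum_singleton] at h
  rw [← h]
  exact (Equiv.subtypeEquivRight fun m : ℤ × ℤ ↦
    show m ∉ ({0} : Finset (ℤ × ℤ)) ↔ m ≠ 0 by simp).hasSum_iff (f := fun m : NonzeroPair ↦ g m)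
    |>.symm

/-- `PeriodPair.G` and `weierstrassPExcept` sum over the whole lattice, with the value 0 at the
origin (for `G` because `0⁻¹ = 0`). -/
lemma tsum_lattice_eq (L : PeriodPair) {f : ℂ → ℂ} (hf : f 0 = 0) :
    ∑' l : L.lattice, f l = ∑' m : NonzeroPair, f (period L.ω₁ L.ω₂ m) := by
  rw [← L.latticeEquivProd.symm.toEquiv.tsum_eq]
  have h1 : ∀ m : ℤ × ℤ, ((L.latticeEquivProd.symm.toEquiv m : L.lattice) : ℂ) =
      period L.ω₁ L.ω₂ m := fun m ↦ L.latticeEquiv_symm_apply m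
  simp only [h1]
  refine (tsum_subtype_eq_of_support_subset (s := {m : ℤ × ℤ | m ≠ 0}) fun m hm h ↦ hm ?_).symm
  simp [h, period, hf]

lemma hasDerivAt_zetaReg (L : PeriodPair) {z : ℂ} (hz : z ∈ regularSet L) :
    HasDerivAt (zetaReg L) (-L.weierstrassPExcept 0 z) z := by
  have hd := ((differentiableOn_zetaReg L).differentiableAt
    ((isOpen_regularSet L).mem_nhds hz)).hasDerivAt
  refine hd.congr_deriv ?_
  have h := (hasSum_iteratedDeriv_zetaReg L 1 hz).tsum_eq
  rw [iteratedDeriv_one] at h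
  rw [← h, PeriodPair.weierstrassPExcept,
    tsum_lattice_eq L (f := fun l ↦ if l = 0 then 0 else 1 / (z - l) ^ 2 - 1 / l ^ 2) (by simp),
    ← tsum_neg]
  refine tsum_congr fun m ↦ ?_
  rw [iteratedDeriv_one_polarPart _ _ _ _ (ne_period_of_mem_regularSet hz m),
    if_neg (period_ne_zero L m), sub_sq_comm z]
  ring

lemma hasDerivAt_weierstrassZeta (L : PeriodPair) {z : ℂ} (hz : z ∉ L.lattice) :
    HasDerivAt (fun z ↦ weierstrassZeta z L.ω₁ L.ω₂) (-L.weierstrassP z) z := by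
  have hz0 : z ≠ 0 := by
    rintro rfl
    exact hz (zero_mem _)
  have h := (hasDerivAt_inv hz0).add
    (hasDerivAt_zetaReg L (compl_lattice_subset_regularSet L hz))
  refine (h.congr_deriv ?_).congr_of_eventuallyEq (Eventually.of_forall fun w ↦ ?_)
  · have := L.weierstrassPExcept_add 0 z
    simp only [ZeroMemClass.coe_zero, sub_zero] at this
    rw [← this]
    simp
  · simp [weierstrassZeta_eq]

lemma weierstrassZeta_neg (L : PeriodPair) (z : ℂ) :
    weierstrassZeta (-z) L.ω₁ L.ω₂ = -weierstrassZeta z L.ω₁ L.ω₂ := by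
  rw [weierstrassZeta_eq, weierstrassZeta_eq, zetaReg_neg, div_neg]
  ring

lemma isPreconnected_compl_lattice (L : PeriodPair) :
    IsPreconnected ((L.lattice : Set ℂ))ᶜ := by
  have hc : (L.lattice : Set ℂ).Countable := by
    rw [← Set.countable_coe_iff]
    exact L.latticeEquivProd.injective.countable
  exact (hc.isConnected_compl_of_one_lt_rank
    (rank_real_complex ▸ Nat.one_lt_ofNat)).isPreconnected

/-- The difference `ζ(z + ω) - ζ(z)` has derivative zero on the connected complement of the lattice,
since `℘` is periodic. Its constant value is read off at `-ω / 2`, where `ζ` is regular and oddness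
gives `2 ζ(ω / 2)`. -/
lemma weierstrassZeta_add_of_half_notMem (L : PeriodPair) {ω : ℂ} (hω : ω ∈ L.lattice)
    (hω2 : ω / 2 ∉ L.lattice) {z : ℂ} (hz : z ∉ L.lattice) :
    weierstrassZeta (z + ω) L.ω₁ L.ω₂ =
      weierstrassZeta z L.ω₁ L.ω₂ + 2 * weierstrassZeta (ω / 2) L.ω₁ L.ω₂ := by
  have hadd : ∀ {w : ℂ}, w ∉ L.lattice → w + ω ∉ L.lattice := fun hw h ↦
    hw ((Submodule.add_mem_iff_left _ hω).mp h)
  have hd : ∀ w ∈ ((L.lattice : Set ℂ))ᶜ, HasDerivAt (fun w ↦ weierstrassZeta (w + ω) L.ω₁ L.ω₂ -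
      weierstrassZeta w L.ω₁ L.ω₂) 0 w := fun w hw ↦ by
    have h1 := (hasDerivAt_weierstrassZeta L (hadd hw)).comp_add_const w ω
    have h2 := h1.sub (hasDerivAt_weierstrassZeta L hw)
    refine h2.congr_deriv ?_
    rw [L.weierstrassP_add_coe w ⟨ω, hω⟩]
    ring
  have hmem : -(ω / 2) ∈ ((L.lattice : Set ℂ))ᶜ := by simpa using hω2
  have h := L.isClosed_lattice.isOpen_compl.is_const_of_deriv_eq_zero
    (isPreconnected_compl_lattice L)
    (fun w hw ↦ (hd w hw).differentiableAt.differentiableWithinAt)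
    (fun w hw ↦ (hd w hw).deriv) (x := z) (y := -(ω / 2)) hz hmem
  rw [show -(ω / 2) + ω = ω / 2 by ring, weierstrassZeta_neg] at h
  linear_combination h

lemma weierstrassZeta_add_period_one (L : PeriodPair) {z : ℂ} (hz : z ∉ L.lattice) :
    weierstrassZeta (z + L.ω₁) L.ω₁ L.ω₂ = weierstrassZeta z L.ω₁ L.ω₂ + eta₁ L.ω₁ L.ω₂ :=
  weierstrassZeta_add_of_half_notMem L L.ω₁_mem_lattice L.ω₁_div_two_notMem_lattice hz

lemma weierstrassZeta_add_period_two (L : PeriodPair) {z : ℂ} (hz : z ∉ L.lattice) :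
    weierstrassZeta (z + L.ω₂) L.ω₁ L.ω₂ = weierstrassZeta z L.ω₁ L.ω₂ + eta₂ L.ω₁ L.ω₂ :=
  weierstrassZeta_add_of_half_notMem L L.ω₂_mem_lattice L.ω₂_div_two_notMem_lattice hz

/-- The expansion of the zeta function at the origin. -/
lemma exists_zetaReg_expansion (L : PeriodPair) :
    ∃ F : ℂ → ℂ, AnalyticAt ℂ F 0 ∧ ∀ᶠ z in 𝓝 0, zetaReg L z = -L.G 4 * z ^ 3 + z ^ 4 * F z := by
  have hA : AnalyticAt ℂ (zetaReg L) 0 := (differentiableOn_zetaReg L).analyticAt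
    ((isOpen_regularSet L).mem_nhds (zero_mem_regularSet L))
  obtain ⟨F, hF, h⟩ := hA.exists_eventuallyEq_sum_add_pow_mul 4
  -- The even Taylor coefficients vanish because `zetaReg` is odd.
  have hodd : ∀ j, Even j → iteratedDeriv j (zetaReg L) 0 = 0 := fun j hj ↦ by
    have h1 := iteratedDeriv_comp_neg j (zetaReg L) 0
    simp only [zetaReg_neg, hj.neg_one_pow, one_smul, neg_zero] at h1
    rw [iteratedDeriv_fun_neg] at h1
    exact CharZero.eq_neg_self_iff.mp h1.symm
  have h1 : iteratedDeriv 1 (zetaReg L) 0 = 0 := by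
    rw [iteratedDeriv_one, (hasDerivAt_zetaReg L (zero_mem_regularSet L)).deriv]
    simp
  have h3 : iteratedDeriv 3 (zetaReg L) 0 = -6 * L.G 4 := by
    rw [← (hasSum_iteratedDeriv_zetaReg L 3 (zero_mem_regularSet L)).tsum_eq, PeriodPair.G,
      tsum_lattice_eq L (f := fun l ↦ (l ^ 4)⁻¹) (by simp), ← tsum_mul_left]
    refine tsum_congr fun m ↦ ?_
    rw [iteratedDeriv_three_polarPart _ _ _ _
      (ne_period_of_mem_regularSet (zero_mem_regularSet L) m), sub_zero]
    ring
  refine ⟨F, hF, h.mono fun z hz ↦ ?_⟩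
  rw [hz]
  simp only [Finset.sum_range_succ, Finset.sum_range_zero, hodd 0 (by decide),
    hodd 2 (by decide), h1, h3, smul_eq_mul]
  simp [Nat.factorial]
  ring

end ZetaReg

/-! ### The series for the derivative in the first period -/

section PeriodSum

/-- The derivative of `ln σ` with respect to the first period, as a series. -/
noncomputable def periodSum (L : PeriodPair) (z : ℂ) : ℂ :=
  ∑' m : NonzeroPair,
    period 1 0 m * z ^ 3 / (period L.ω₁ L.ω₂ m ^ 3 * (period L.ω₁ L.ω₂ m - z))

lemma periodSum_summand_eq_polarPart {z ω : ℂ} (p : ℂ) (hω : ω ≠ 0) (hz : z ≠ ω) :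
    p * z ^ 3 / (ω ^ 3 * (ω - z)) =
      polarPart p (-p / ω) (-p / ω ^ 2) (-p / ω ^ 3) ω z := by
  have : ω - z ≠ 0 := sub_ne_zero.mpr hz.symm
  rw [polarPart]
  field_simp
  ring

lemma differentiableOn_periodSum_summand (L : PeriodPair) (m : NonzeroPair) :
    DifferentiableOn ℂ (fun z ↦ period 1 0 m * z ^ 3 /
      (period L.ω₁ L.ω₂ m ^ 3 * (period L.ω₁ L.ω₂ m - z))) (regularSet L) := by
  refine DifferentiableOn.div (by fun_prop) (by fun_prop) fun z hz ↦ ?_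
  exact mul_ne_zero (pow_ne_zero _ (period_ne_zero L m))
    (sub_ne_zero.mpr (ne_period_of_mem_regularSet hz m).symm)

lemma differentiableOn_periodSum (L : PeriodPair) :
    DifferentiableOn ℂ (periodSum L) (regularSet L) :=
  differentiableOn_tsum_of_index_bound (isOpen_regularSet L)
    (differentiableOn_periodSum_summand L) (exists_norm_period_mul_le L 1 0)

lemma hasSum_iteratedDeriv_periodSum (L : PeriodPair) (j : ℕ) {z : ℂ} (hz : z ∈ regularSet L) :
    HasSum (fun m : NonzeroPair ↦ iteratedDeriv j
      (polarPart (period 1 0 m) (-period 1 0 m / period L.ω₁ L.ω₂ m)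
        (-period 1 0 m / period L.ω₁ L.ω₂ m ^ 2) (-period 1 0 m / period L.ω₁ L.ω₂ m ^ 3)
        (period L.ω₁ L.ω₂ m)) z) (iteratedDeriv j (periodSum L) z) := by
  have h := hasSum_iteratedDeriv_of_index_bound (isOpen_regularSet L)
    (differentiableOn_periodSum_summand L) (exists_norm_period_mul_le L 1 0) j hz
  refine h.congr_fun fun m ↦ ?_
  refine Filter.EventuallyEq.iteratedDeriv_eq j ?_
  filter_upwards [(isOpen_regularSet L).mem_nhds hz] with w hw
  exact (periodSum_summand_eq_polarPart _ (period_ne_zero L m)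
    (ne_period_of_mem_regularSet hw m)).symm

lemma periodSum_neg (L : PeriodPair) (z : ℂ) : periodSum L (-z) = periodSum L z := by
  simp only [periodSum]
  rw [← negIndex.tsum_eq]
  congr! 2 with m
  rw [period_negIndex, period_negIndex, sub_neg_eq_add, neg_add_eq_sub, ← neg_sub z]
  ring

lemma exists_periodSum_expansion (L : PeriodPair) :
    ∃ F : ℂ → ℂ, AnalyticAt ℂ F 0 ∧ ∀ᶠ z in 𝓝 0, periodSum L z = z ^ 3 * F z := by
  have hA : AnalyticAt ℂ (periodSum L) 0 := (differentiableOn_periodSum L).analyticAt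
    ((isOpen_regularSet L).mem_nhds (zero_mem_regularSet L))
  obtain ⟨F, hF, h⟩ := hA.exists_eventuallyEq_sum_add_pow_mul 3
  have h0 : iteratedDeriv 0 (periodSum L) 0 = 0 := by simp [periodSum]
  have h1 : iteratedDeriv 1 (periodSum L) 0 = 0 := by
    rw [← (hasSum_iteratedDeriv_periodSum L 1 (zero_mem_regularSet L)).tsum_eq]
    refine (tsum_congr fun m ↦ ?_).trans tsum_zero
    rw [iteratedDeriv_one_polarPart _ _ _ _
      (ne_period_of_mem_regularSet (zero_mem_regularSet L) m)]
    ring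
  have h2 : iteratedDeriv 2 (periodSum L) 0 = 0 := by
    rw [← (hasSum_iteratedDeriv_periodSum L 2 (zero_mem_regularSet L)).tsum_eq]
    refine (tsum_congr fun m ↦ ?_).trans tsum_zero
    rw [iteratedDeriv_two_polarPart _ _ _ _
      (ne_period_of_mem_regularSet (zero_mem_regularSet L) m)]
    ring
  refine ⟨F, hF, h.mono fun z hz ↦ ?_⟩
  rw [hz]
  simp [Finset.sum_range_succ, -iteratedDeriv_zero, -iteratedDeriv_one, h0, h1, h2]

/-- Three derivatives remove the quadratic correction of each summand. The index 0 may be added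
freely, since there `period 1 0 m = 0`. -/
lemma hasSum_iteratedDeriv_three_periodSum (L : PeriodPair) {z : ℂ} (hz : z ∉ L.lattice) :
    HasSum (fun m : ℤ × ℤ ↦ 6 * period 1 0 m / (period L.ω₁ L.ω₂ m - z) ^ 4)
      (iteratedDeriv 3 (periodSum L) z) := by
  have hz' := compl_lattice_subset_regularSet L hz
  have h := (hasSum_iteratedDeriv_periodSum L 3 hz').congr_fun fun m ↦
    (iteratedDeriv_three_polarPart _ _ _ _ (ne_period_of_mem_regularSet hz' m)).symm
  rw [hasSum_nonzeroPair_iff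
    (g := fun m ↦ 6 * period 1 0 m / (period L.ω₁ L.ω₂ m - z) ^ 4)] at h
  simpa [period] using h

lemma hasSum_iteratedDeriv_three_weierstrassZeta (L : PeriodPair) {z : ℂ} (hz : z ∉ L.lattice) :
    HasSum (fun m : ℤ × ℤ ↦ -6 / (period L.ω₁ L.ω₂ m - z) ^ 4)
      (iteratedDeriv 3 (fun z ↦ weierstrassZeta z L.ω₁ L.ω₂) z) := by
  have hz' := compl_lattice_subset_regularSet L hz
  have hz0 : z ≠ 0 := by
    rintro rfl
    exact hz (zero_mem _)
  have h := (hasSum_iteratedDeriv_zetaReg L 3 hz').congr_fun fun m ↦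
    (iteratedDeriv_three_polarPart _ _ _ _ (ne_period_of_mem_regularSet hz' m)).symm
  rw [hasSum_nonzeroPair_iff
    -- The term of index 0 is the third derivative of the principal part `1 / z`.
    (g := fun m ↦ 6 * -1 / (period L.ω₁ L.ω₂ m - z) ^ 4)] at h
  have h3 : iteratedDeriv 3 (fun z ↦ weierstrassZeta z L.ω₁ L.ω₂) z =
      iteratedDeriv 3 (polarPart (-1) 0 0 0 0) z + iteratedDeriv 3 (zetaReg L) z := by
    have : (fun z ↦ weierstrassZeta z L.ω₁ L.ω₂) =
        fun z ↦ polarPart (-1) 0 0 0 0 z + zetaReg L z := by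
      funext w
      simp [weierstrassZeta_eq, polarPart]
    rw [this]
    refine iteratedDeriv_fun_add ?_ ?_
    · exact ((differentiableOn_polarPart (U := {0}ᶜ) _ _ _ _ fun w hw ↦ hw).analyticAt
        (isOpen_compl_singleton.mem_nhds hz0)).contDiffAt
    · exact ((differentiableOn_zetaReg L).analyticAt
        ((isOpen_regularSet L).mem_nhds hz')).contDiffAt
  rw [h3, iteratedDeriv_three_polarPart _ _ _ _ hz0, add_comm]
  simpa [period] using h

/-- Shifting `m₁` by one turns the numerator `6 m₁` into `6 m₁ + 6`; the extra terms sum to `-ζ'''`.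
-/
lemma iteratedDeriv_three_periodSum_add_one (L : PeriodPair) {z : ℂ} (hz : z ∉ L.lattice) :
    iteratedDeriv 3 (periodSum L) (z + L.ω₁) = iteratedDeriv 3 (periodSum L) z -
      iteratedDeriv 3 (fun z ↦ weierstrassZeta z L.ω₁ L.ω₂) z := by
  have hz' : z + L.ω₁ ∉ L.lattice := fun h ↦
    hz ((Submodule.add_mem_iff_left _ L.ω₁_mem_lattice).mp h)
  have h1 := hasSum_iteratedDeriv_three_periodSum L hz'
  rw [← (Equiv.addRight ((1, 0) : ℤ × ℤ)).hasSum_iff] at h1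
  refine h1.unique (((hasSum_iteratedDeriv_three_periodSum L hz).sub
    (hasSum_iteratedDeriv_three_weierstrassZeta L hz)).congr_fun fun m ↦ ?_)
  have : period L.ω₁ L.ω₂ (m + (1, 0)) - (z + L.ω₁) = period L.ω₁ L.ω₂ m - z := by
    simp [period]
    ring
  simp only [Function.comp_apply, Equiv.coe_addRight, this]
  simp [period]
  ring

lemma iteratedDeriv_three_periodSum_add_two (L : PeriodPair) {z : ℂ} (hz : z ∉ L.lattice) :
    iteratedDeriv 3 (periodSum L) (z + L.ω₂) = iteratedDeriv 3 (periodSum L) z := by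
  have hz' : z + L.ω₂ ∉ L.lattice := fun h ↦
    hz ((Submodule.add_mem_iff_left _ L.ω₂_mem_lattice).mp h)
  have h1 := hasSum_iteratedDeriv_three_periodSum L hz'
  rw [← (Equiv.addRight ((0, 1) : ℤ × ℤ)).hasSum_iff] at h1
  refine h1.unique ((hasSum_iteratedDeriv_three_periodSum L hz).congr_fun fun m ↦ ?_)
  have : period L.ω₁ L.ω₂ (m + (0, 1)) - (z + L.ω₂) = period L.ω₁ L.ω₂ m - z := by
    simp [period]
    ring
  simp only [Function.comp_apply, Equiv.coe_addRight, this]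
  simp [period]

end PeriodSum

/-! ### Comparison of the series with the closed form by Liouville's theorem -/

/-- The singularity at 0 is removable, hence by periodicity so is the one at every lattice point.
The extended function is entire and doubly periodic, hence bounded and constant. -/
lemma eq_of_periodic_of_eventuallyEq_analyticAt (L : PeriodPair) {f g : ℂ → ℂ}
    (hf : DifferentiableOn ℂ f ((L.lattice : Set ℂ))ᶜ)
    (h₁ : ∀ z ∉ L.lattice, f (z + L.ω₁) = f z) (h₂ : ∀ z ∉ L.lattice, f (z + L.ω₂) = f z)
    (hg : AnalyticAt ℂ g 0) (hfg : ∀ᶠ z in 𝓝[≠] 0, f z = g z) {z : ℂ} (hz : z ∉ L.lattice) :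
    f z = g 0 := by
  classical
  let F : ℂ → ℂ := fun z ↦ if z ∈ L.lattice then g 0 else f z
  let P : AddSubgroup ℂ :=
    { carrier := {w | (F <| · + w) = F}
      add_mem' := by simp_all [funext_iff, ← add_assoc]
      zero_mem' := by simp
      neg_mem' {w} hw := funext fun i ↦ by conv_lhs => rw [← hw]; simp }
  have hP : ∀ ω ∈ L.lattice, (∀ z ∉ L.lattice, f (z + ω) = f z) → ω ∈ P := by
    intro ω hω h
    refine funext fun w ↦ ?_
    simp only [F, Submodule.add_mem_iff_left _ hω]
    split_ifs with hw
    · rfl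
    · exact h w hw
  have hper : ∀ w ω, ω ∈ L.lattice → F (w + ω) = F w := by
    intro w ω hω
    obtain ⟨m, n, rfl⟩ := PeriodPair.mem_lattice.mp hω
    have h3 : (m * L.ω₁ + n * L.ω₂ : ℂ) ∈ P := by
      simpa using P.add_mem (P.zsmul_mem (hP _ L.ω₁_mem_lattice h₁) m)
        (P.zsmul_mem (hP _ L.ω₂_mem_lattice h₂) n)
    exact congr_fun h3 w
  have hF0 : AnalyticAt ℂ F 0 := by
    refine hg.congr ?_
    rw [eventually_nhdsWithin_iff] at hfg
    filter_upwards [hfg, L.compl_lattice_sdiff_singleton_mem_nhds 0] with w hw hw'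
    by_cases hw0 : w = 0
    · simp [F, hw0]
    · have : w ∉ L.lattice := fun h ↦ hw' ⟨h, hw0⟩
      simp only [F, this, if_false]
      exact (hw hw0).symm
  have hF : Differentiable ℂ F := by
    intro w
    by_cases hw : w ∈ L.lattice
    · have h4 : AnalyticAt ℂ (fun x ↦ F (x - w)) w := by
        rw [← sub_self w] at hF0
        exact hF0.comp (f := (· - w)) (by fun_prop)
      refine (h4.congr (Eventually.of_forall fun x ↦ ?_)).differentiableAt
      have := hper (x - w) w hw
      rw [sub_add_cancel] at this
      exact this.symm
    · refine (hf.differentiableAt (L.isClosed_lattice.isOpen_compl.mem_nhds hw)).congr_of_eventuallyEq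
        ?_
      filter_upwards [L.isClosed_lattice.isOpen_compl.mem_nhds hw] with x hx
      exact if_neg hx
  have := hF.apply_eq_apply_of_bounded (IsZLattice.isCompact_range_of_periodic L.lattice F
    hF.continuous hper).isBounded z 0
  simpa [F, hz] using this

/-- An analytic function divisible by `z ^ 3` whose third derivative vanishes is zero. -/
lemma eventually_eq_zero_of_iteratedDeriv_three {u : ℂ → ℂ} (hu : AnalyticAt ℂ u 0)
    (h : ∀ᶠ z in 𝓝 0, iteratedDeriv 3 (fun z ↦ z ^ 3 * u z) z = 0) :
    ∀ᶠ z in 𝓝 0, z ^ 3 * u z = 0 := by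
  set G : ℂ → ℂ := fun z ↦ z ^ 3 * u z
  have hG : AnalyticAt ℂ G 0 := by fun_prop
  rw [← analyticOrderAt_eq_top] at h ⊢
  by_contra hne
  obtain ⟨n, hn⟩ := ENat.ne_top_iff_exists.mp hne
  have h3 : ((3 : ℕ) : ℕ∞) ≤ analyticOrderAt G 0 := by
    rw [natCast_le_analyticOrderAt hG]
    exact ⟨u, hu, Eventually.of_forall fun z ↦ by simp [G]⟩
  rw [← hn, Nat.cast_le] at h3
  -- A finite order `n ≥ 3` would drop to the finite order `n - 3`, whereas the third derivative has
  -- infinite order.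
  have := analyticOrderAt_iterated_deriv hG (k := 3) hn (by simp; lia) (by exact_mod_cast h3)
  rw [iteratedDeriv_eq_iterate] at h
  rw [h] at this
  exact absurd this.symm (by simp)

/-- The right hand side of the formula for `2πi ∂ ln σ / ∂ω₁`. -/
noncomputable def periodForm (L : PeriodPair) (z : ℂ) : ℂ :=
  1 / 2 * L.ω₂ * (L.weierstrassP z - weierstrassZeta z L.ω₁ L.ω₂ ^ 2)
    + eta₂ L.ω₁ L.ω₂ * (z * weierstrassZeta z L.ω₁ L.ω₂ - 1) - L.ω₂ * (L.g₂ / 24) * z ^ 2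

/-- The Legendre determinant. -/
noncomputable def legendre (L : PeriodPair) : ℂ :=
  eta₁ L.ω₁ L.ω₂ * L.ω₂ - eta₂ L.ω₁ L.ω₂ * L.ω₁

/-- The difference of the two sides of the formula for the derivative with respect to `ω₁`. -/
noncomputable def defect (L : PeriodPair) (z : ℂ) : ℂ :=
  legendre L * periodSum L z - periodForm L z

lemma analyticOnNhd_weierstrassZeta (L : PeriodPair) :
    AnalyticOnNhd ℂ (fun z ↦ weierstrassZeta z L.ω₁ L.ω₂) ((L.lattice : Set ℂ))ᶜ :=
  DifferentiableOn.analyticOnNhd (fun _ hz ↦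
    (hasDerivAt_weierstrassZeta L hz).differentiableAt.differentiableWithinAt)
    L.isClosed_lattice.isOpen_compl

lemma analyticAt_periodSum (L : PeriodPair) {z : ℂ} (hz : z ∉ L.lattice) :
    AnalyticAt ℂ (periodSum L) z :=
  (differentiableOn_periodSum L).analyticAt
    ((isOpen_regularSet L).mem_nhds (compl_lattice_subset_regularSet L hz))

lemma analyticOnNhd_periodForm (L : PeriodPair) :
    AnalyticOnNhd ℂ (periodForm L) ((L.lattice : Set ℂ))ᶜ := fun z hz ↦ by
  have h1 := analyticOnNhd_weierstrassZeta L z hz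
  have h2 := L.analyticOnNhd_weierstrassP z hz
  unfold periodForm
  fun_prop

lemma analyticOnNhd_defect (L : PeriodPair) :
    AnalyticOnNhd ℂ (defect L) ((L.lattice : Set ℂ))ᶜ := fun z hz ↦ by
  have h1 := analyticAt_periodSum L hz
  have h2 := analyticOnNhd_periodForm L z hz
  unfold defect
  fun_prop

lemma defect_neg (L : PeriodPair) (z : ℂ) : defect L (-z) = defect L z := by
  simp only [defect, periodForm, periodSum_neg, weierstrassZeta_neg, L.weierstrassP_neg]
  ring

lemma add_notMem_lattice {L : PeriodPair} {z ω : ℂ} (hω : ω ∈ L.lattice) (hz : z ∉ L.lattice) :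
    z + ω ∉ L.lattice :=
  fun h ↦ hz ((Submodule.add_mem_iff_left _ hω).mp h)

lemma iteratedDeriv_three_affine (b c z : ℂ) : iteratedDeriv 3 (fun w ↦ b + c * w) z = 0 := by
  have h : (fun w ↦ b + c * w) = polarPart 0 b c 0 (z + 1) := by
    funext w
    simp [polarPart]
  rw [h, iteratedDeriv_three_polarPart _ _ _ _ (by simp)]
  simp

lemma iteratedDeriv_three_defect (L : PeriodPair) {z : ℂ} (hz : z ∉ L.lattice) :
    iteratedDeriv 3 (defect L) z =
      legendre L * iteratedDeriv 3 (periodSum L) z - iteratedDeriv 3 (periodForm L) z := by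
  have h1 := (analyticAt_periodSum L hz).contDiffAt (n := 3)
  have h2 := (analyticOnNhd_periodForm L z hz).contDiffAt (n := 3)
  have h := iteratedDeriv_fun_sub (n := 3) (contDiffAt_const (c := legendre L) |>.mul h1) h2
  simp only [iteratedDeriv_const_mul_field] at h
  exact h

/-- Expanding `(ζ + η)²` and `(z + ω)(ζ + η)` leaves the change `-k ζ` plus an affine function of
`z`, which the third derivative kills. For `ω = ω₁` the constant `k` is the Legendre determinant;
for `ω = ω₂` it is 0. -/
lemma iteratedDeriv_three_periodForm_add (L : PeriodPair) {z ω : ℂ} (hω : ω ∈ L.lattice)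
    {η k : ℂ} (hη : ∀ w ∉ L.lattice,
      weierstrassZeta (w + ω) L.ω₁ L.ω₂ = weierstrassZeta w L.ω₁ L.ω₂ + η)
    (hk : k = η * L.ω₂ - eta₂ L.ω₁ L.ω₂ * ω) (hz : z ∉ L.lattice) :
    iteratedDeriv 3 (periodForm L) (z + ω) = iteratedDeriv 3 (periodForm L) z -
      k * iteratedDeriv 3 (fun z ↦ weierstrassZeta z L.ω₁ L.ω₂) z := by
  rw [← congr_fun (iteratedDeriv_comp_add_const 3 (periodForm L) ω) z]
  have h : (fun w ↦ periodForm L (w + ω)) =ᶠ[𝓝 z] fun w ↦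
      periodForm L w - k * weierstrassZeta w L.ω₁ L.ω₂ +
        ((-(1 / 2) * L.ω₂ * η ^ 2 + eta₂ L.ω₁ L.ω₂ * ω * η - L.ω₂ * (L.g₂ / 24) * ω ^ 2) +
          (eta₂ L.ω₁ L.ω₂ * η - 2 * L.ω₂ * (L.g₂ / 24) * ω) * w) := by
    filter_upwards [L.isClosed_lattice.isOpen_compl.mem_nhds hz] with w hw
    rw [periodForm, periodForm, hη w hw, L.weierstrassP_add_coe w ⟨ω, hω⟩, hk]
    ring
  rw [h.iteratedDeriv_eq 3]
  have h1 := (analyticOnNhd_periodForm L z hz).contDiffAt (n := 3)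
  have h2 := (analyticOnNhd_weierstrassZeta L z hz).contDiffAt (n := 3)
  have h3 := contDiffAt_const (c := k) |>.mul h2
  rw [iteratedDeriv_fun_add (n := 3) (h1.sub h3) (by fun_prop), iteratedDeriv_three_affine,
    iteratedDeriv_fun_sub (n := 3) h1 h3, iteratedDeriv_const_mul_field]
  ring

lemma iteratedDeriv_three_defect_add_one (L : PeriodPair) {z : ℂ} (hz : z ∉ L.lattice) :
    iteratedDeriv 3 (defect L) (z + L.ω₁) = iteratedDeriv 3 (defect L) z := by
  rw [iteratedDeriv_three_defect L hz,
    iteratedDeriv_three_defect L (add_notMem_lattice L.ω₁_mem_lattice hz),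
    iteratedDeriv_three_periodSum_add_one L hz,
    iteratedDeriv_three_periodForm_add L L.ω₁_mem_lattice
      (fun w hw ↦ weierstrassZeta_add_period_one L hw) rfl hz, legendre]
  ring

lemma iteratedDeriv_three_defect_add_two (L : PeriodPair) {z : ℂ} (hz : z ∉ L.lattice) :
    iteratedDeriv 3 (defect L) (z + L.ω₂) = iteratedDeriv 3 (defect L) z := by
  rw [iteratedDeriv_three_defect L hz,
    iteratedDeriv_three_defect L (add_notMem_lattice L.ω₂_mem_lattice hz),
    iteratedDeriv_three_periodSum_add_two L hz,
    iteratedDeriv_three_periodForm_add L L.ω₂_mem_lattice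
      (fun w hw ↦ weierstrassZeta_add_period_two L hw) rfl hz]
  ring

lemma exists_defect_expansion (L : PeriodPair) :
    ∃ u : ℂ → ℂ, AnalyticAt ℂ u 0 ∧ ∀ᶠ z in 𝓝[≠] 0, defect L z = z ^ 3 * u z := by
  obtain ⟨F₁, hF₁, h₁⟩ := exists_periodSum_expansion L
  obtain ⟨F₂, hF₂, h₂⟩ := exists_zetaReg_expansion L
  have hP : ∀ᶠ z in 𝓝 0, L.weierstrassPExcept 0 z =
      3 * L.G 4 * z ^ 2 - 4 * z ^ 3 * F₂ z - z ^ 4 * deriv F₂ z := by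
    filter_upwards [h₂.eventually_nhds, hF₂.eventually_analyticAt,
      (isOpen_regularSet L).mem_nhds (zero_mem_regularSet L)] with z hz hFz hzr
    have hd := (((hasDerivAt_id z).pow 3).const_mul (-L.G 4)).add
      (((hasDerivAt_id z).pow 4).mul hFz.differentiableAt.hasDerivAt)
    have := (hasDerivAt_zetaReg L hzr).unique (hd.congr_of_eventuallyEq hz)
    simp at this
    linear_combination -this
  have hF₂' : AnalyticAt ℂ (deriv F₂) 0 := hF₂.deriv
  -- The double poles of `℘` and `ζ²` cancel, and so do the `z²` terms: `(℘ - ζ²) / 2` contributes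
  -- `(3 + 2) G₄ / 2`, which equals `g₂ / 24`. The witness is what remains after division by `z ^
  -- 3`.
  refine ⟨fun z ↦ legendre L * F₁ z - (1 / 2 * L.ω₂ * (-6 * F₂ z - z * deriv F₂ z
    - z ^ 3 * (-L.G 4 + z * F₂ z) ^ 2) + eta₂ L.ω₁ L.ω₂ * (z * (-L.G 4 + z * F₂ z))),
    by fun_prop, ?_⟩
  filter_upwards [self_mem_nhdsWithin, h₁.filter_mono nhdsWithin_le_nhds,
    h₂.filter_mono nhdsWithin_le_nhds, hP.filter_mono nhdsWithin_le_nhds] with z hz h1 h2 h3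
  have hz : z ≠ 0 := hz
  have h4 := L.weierstrassPExcept_add 0 z
  simp only [ZeroMemClass.coe_zero, sub_zero] at h4
  rw [defect, periodForm, ← h4, h3, weierstrassZeta_eq, h1, h2, PeriodPair.g₂]
  field_simp
  ring

lemma defect_eq_zero (L : PeriodPair) {z : ℂ} (hz : z ∉ L.lattice) : defect L z = 0 := by
  obtain ⟨u, hu, h⟩ := exists_defect_expansion L
  have hG : AnalyticAt ℂ (fun z ↦ z ^ 3 * u z) 0 := by fun_prop
  have hG3 : AnalyticAt ℂ (iteratedDeriv 3 (fun z ↦ z ^ 3 * u z)) 0 := by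
    rw [iteratedDeriv_eq_iterate]
    exact hG.iterated_deriv 3
  have hloc : ∀ᶠ w in 𝓝[≠] (0 : ℂ), defect L =ᶠ[𝓝 w] fun z ↦ z ^ 3 * u z := by
    filter_upwards [eventually_eventually_nhdsWithin.mpr h, self_mem_nhdsWithin] with w hw hw0
    rwa [isOpen_compl_singleton.nhdsWithin_eq hw0] at hw
  have hd3 : DifferentiableOn ℂ (iteratedDeriv 3 (defect L)) ((L.lattice : Set ℂ))ᶜ := by
    rw [iteratedDeriv_eq_iterate]
    exact fun w hw ↦
      ((analyticOnNhd_defect L).iterated_deriv 3 w hw).differentiableAt.differentiableWithinAt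
  have hconst : ∀ w ∉ L.lattice, iteratedDeriv 3 (defect L) w =
      iteratedDeriv 3 (fun z ↦ z ^ 3 * u z) 0 := fun w hw ↦
    eq_of_periodic_of_eventuallyEq_analyticAt L hd3
      (fun w hw ↦ iteratedDeriv_three_defect_add_one L hw)
      (fun w hw ↦ iteratedDeriv_three_defect_add_two L hw) hG3
      (hloc.mono fun w hw ↦ hw.iteratedDeriv_eq 3) hw
  -- `defect` is even, so its third derivative is odd; a constant odd function is zero.
  have hzero : iteratedDeriv 3 (fun z ↦ z ^ 3 * u z) 0 = 0 := by
    have h1 := iteratedDeriv_comp_neg 3 (defect L) z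
    simp only [defect_neg] at h1
    rw [hconst z hz, hconst (-z) (by simpa using hz)] at h1
    rw [← CharZero.eq_neg_self_iff]
    simpa [Odd.neg_one_pow (show Odd 3 by decide)] using h1
  have hpunct : ∀ᶠ w in 𝓝[≠] (0 : ℂ), w ∉ L.lattice := by
    filter_upwards [self_mem_nhdsWithin,
      mem_nhdsWithin_of_mem_nhds (L.compl_lattice_sdiff_singleton_mem_nhds 0)] with w hw0 hw h
    exact hw ⟨h, hw0⟩
  have hG30 : ∀ᶠ w in 𝓝 0, iteratedDeriv 3 (fun z ↦ z ^ 3 * u z) w = 0 := by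
    refine hG3.frequently_zero_iff_eventually_zero.mp (Eventually.frequently ?_)
    filter_upwards [hloc, hpunct] with w hw hw'
    rw [← hw.iteratedDeriv_eq 3, hconst w hw', hzero]
  have hG0 := eventually_eq_zero_of_iteratedDeriv_three hu hG30
  obtain ⟨w, hw1, hw2, hw3⟩ := (hloc.and (hpunct.and
    (hG0.eventually_nhds.filter_mono nhdsWithin_le_nhds))).exists
  exact (analyticOnNhd_defect L).eqOn_zero_of_preconnected_of_eventuallyEq_zero
    (isPreconnected_compl_lattice L) hw2 (hw1.trans hw3) hz

/-- The formula for the derivative of `ln σ` with respect to `ω₁`, up to the value of the Legendre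
determinant. -/
lemma legendre_mul_periodSum (L : PeriodPair) {z : ℂ} (hz : z ∉ L.lattice) :
    legendre L * periodSum L z = periodForm L z :=
  sub_eq_zero.mp (defect_eq_zero L hz)

/-! ### Legendre's relation -/

/-- Half the winding of the boundary of the period parallelogram about the pole at 0. The logarithms
on the left combine through `(1 + τ) / 2 = τ (1 + τ⁻¹) / 2` and `(1 - τ⁻¹) / 2 = -τ⁻¹ (1 - τ) / 2`:
in each product the arguments have opposite signs, so `log` is additive. The value `πi` comes from
`log (-τ⁻¹) = -log τ + πi`, where the orientation `Im τ > 0` enters. -/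
lemma log_half_add_sub_log_half_sub {τ : ℂ} (hτ : 0 < τ.im) :
    log (1 / 2 + 1 / 2 * τ) - log (1 / 2 - 1 / 2 * τ) - log (1 / 2 + 1 / 2 * τ⁻¹) +
      log (1 / 2 - 1 / 2 * τ⁻¹) = Real.pi * I := by
  have hτ0 : τ ≠ 0 := by
    rintro rfl
    simp at hτ
  have him : τ⁻¹.im < 0 := by
    rw [inv_im]
    exact div_neg_of_neg_of_pos (by linarith) (normSq_pos.mpr hτ0)
  have ne_zero_of_im : ∀ {w : ℂ}, w.im ≠ 0 → w ≠ 0 := fun h h0 ↦ h (by simp [h0])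
  have arg_pos : ∀ {w : ℂ}, 0 < w.im → 0 < arg w ∧ arg w < Real.pi := fun {w} h ↦
    ⟨lt_of_le_of_ne (arg_nonneg_iff.mpr h.le) fun h0 ↦
      h.ne' (arg_eq_zero_iff.mp h0.symm).2, lt_of_le_of_ne (arg_le_pi w) fun h0 ↦
      h.ne' (arg_eq_pi_iff.mp h0).2⟩
  have arg_neg : ∀ {w : ℂ}, w.im < 0 → -Real.pi < arg w ∧ arg w < 0 := fun {w} h ↦
    ⟨neg_pi_lt_arg w, arg_neg_iff.mpr h⟩
  have i1 : (1 / 2 + 1 / 2 * τ⁻¹ : ℂ).im < 0 := by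
    have : (1 / 2 + 1 / 2 * τ⁻¹ : ℂ).im = 1 / 2 * τ⁻¹.im := by
      rw [show (1 / 2 + 1 / 2 * τ⁻¹ : ℂ) = (1 / 2 : ℝ) + (1 / 2 : ℝ) * τ⁻¹ by push_cast; rfl,
        add_im, ofReal_im, im_ofReal_mul, zero_add]
    linarith
  have i2 : (1 / 2 - 1 / 2 * τ : ℂ).im < 0 := by
    have : (1 / 2 - 1 / 2 * τ : ℂ).im = -(1 / 2 * τ.im) := by simp
    linarith
  have i3 : 0 < (-τ⁻¹).im := by
    rw [neg_im]
    linarith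
  have e1 : log (1 / 2 + 1 / 2 * τ) = log τ + log (1 / 2 + 1 / 2 * τ⁻¹) := by
    rw [← log_mul hτ0 (ne_zero_of_im i1.ne)]
    · congr 1
      field_simp
      ring
    · have h1 := arg_pos hτ
      have h2 := arg_neg i1
      constructor <;> linarith
  have e2 : log (1 / 2 - 1 / 2 * τ⁻¹) = log (1 / 2 - 1 / 2 * τ) + log (-τ⁻¹) := by
    rw [← log_mul (ne_zero_of_im i2.ne) (ne_zero_of_im i3.ne')]
    · congr 1
      field_simp
      ring
    · have h1 := arg_pos i3
      have h2 := arg_neg i2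
      constructor <;> linarith
  have e3 : log (-τ⁻¹) = -log τ + Real.pi * I := by
    rw [← log_inv τ (arg_pos hτ).2.ne, log, log, norm_neg,
      arg_neg_eq_arg_add_pi_of_im_neg him]
    push_cast
    ring
  rw [e1, e2, e3]
  ring

/-- The open parallelogram of points whose coordinates with respect to the periods have absolute
value less than one. -/
def periodBox (L : PeriodPair) : Set ℂ := L.basis.equivFun ⁻¹' Metric.ball 0 1

lemma isOpen_periodBox (L : PeriodPair) : IsOpen (periodBox L) :=
  Metric.isOpen_ball.preimage (L.basis.equivFun.toLinearMap.continuous_of_finiteDimensional)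

lemma convex_periodBox (L : PeriodPair) : Convex ℝ (periodBox L) :=
  (convex_ball (0 : Fin 2 → ℝ) 1).linear_preimage L.basis.equivFun.toLinearMap

lemma real_combination_mem_periodBox (L : PeriodPair) {x y : ℝ} :
    (x * L.ω₁ + y * L.ω₂ : ℂ) ∈ periodBox L ↔ |x| < 1 ∧ |y| < 1 := by
  have h : (x * L.ω₁ + y * L.ω₂ : ℂ) = L.basis.equivFun.symm ![x, y] := by
    simp [Module.Basis.equivFun_symm_apply]
  rw [periodBox, Set.mem_preimage, h, LinearEquiv.apply_symm_apply, mem_ball_zero_iff,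
    pi_norm_lt_iff one_pos]
  simp [Fin.forall_fin_two]

lemma periodBox_subset_regularSet (L : PeriodPair) : periodBox L ⊆ regularSet L := by
  rintro z hz ⟨hzL, hz0⟩
  obtain ⟨m, n, rfl⟩ := PeriodPair.mem_lattice.mp hzL
  have := (real_combination_mem_periodBox L (x := m) (y := n)).mp (by simpa using hz)
  have h1 : m = 0 := Int.abs_lt_one_iff.mp (by exact_mod_cast this.1)
  have h2 : n = 0 := Int.abs_lt_one_iff.mp (by exact_mod_cast this.2)
  exact hz0 (by simp [h1, h2])

lemma exists_primitive_zetaReg (L : PeriodPair) :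
    ∃ P : ℂ → ℂ, ∀ z ∈ periodBox L, HasDerivAt P (zetaReg L z) z := by
  obtain ⟨P, hP⟩ := (convex_periodBox L).exists_forall_hasDerivWithinAt
    ((differentiableOn_zetaReg L).mono (periodBox_subset_regularSet L))
  exact ⟨P, fun z hz ↦ (hP z hz).hasDerivAt ((isOpen_periodBox L).mem_nhds hz)⟩

lemma half_add_mul_mem_slitPlane {s : ℂ} (hs : s.im ≠ 0) (t : ℝ) :
    1 / 2 + t * s ∈ slitPlane := by
  rw [mem_slitPlane_iff]
  by_cases ht : t = 0
  · left
    simp [ht]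
  · right
    simpa using ⟨ht, hs⟩

/-- The quasi-period `η` of `ζ` for the period `α`, obtained by integrating `ζ` along two opposite
edges of the period parallelogram. -/
lemma quasiperiod_mul_eq (L : PeriodPair) {P : ℂ → ℂ}
    (hP : ∀ z ∈ periodBox L, HasDerivAt P (zetaReg L z) z) {α β η : ℂ}
    (hα : α ≠ 0) (hs : (β / α).im ≠ 0)
    (hp : ∀ t : ℝ, |t| < 1 → α / 2 + t * β ∈ periodBox L)
    (hq : ∀ t : ℝ, |t| < 1 → -α / 2 + t * β ∈ periodBox L)
    (hη : ∀ t : ℝ, |t| < 1 → weierstrassZeta (α / 2 + t * β) L.ω₁ L.ω₂ =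
      weierstrassZeta (-α / 2 + t * β) L.ω₁ L.ω₂ + η) :
    η * β = (P (α / 2 + β / 2) - P (-α / 2 + β / 2) - P (α / 2 - β / 2) + P (-α / 2 - β / 2)) +
      2 * (log (1 / 2 + 1 / 2 * (β / α)) - log (1 / 2 - 1 / 2 * (β / α))) := by
  set s := β / α with hs_def
  have hβ : β = s * α := by rw [hs_def, div_mul_cancel₀ _ hα]
  -- A primitive in `t` of `β (ζ(α/2 + tβ) - ζ(-α/2 + tβ) - η)`, which is 0. The pole `1 / z` is
  -- integrated by logarithms of `±z / α`, which stay in the slit plane.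
  let g : ℝ → ℂ := fun t ↦ P (α / 2 + t * β) - P (-α / 2 + t * β) +
    (log (1 / 2 + t * s) - log (1 / 2 + t * -s)) - t * (η * β)
  -- The interval is longer than the edge, so that the corners `t = ±1/2` are interior points.
  have hg : ∀ t ∈ Set.Ioo (-1 : ℝ) 1, HasDerivAt g 0 t := by
    intro t ht
    have ht' : |t| < 1 := abs_lt.mpr ht
    have hid : HasDerivAt (fun t : ℝ ↦ (t : ℂ)) 1 t := (hasDerivAt_id t).ofReal_comp
    have hlin : ∀ a b : ℂ, HasDerivAt (fun t : ℝ ↦ a + t * b) b t := fun a b ↦ by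
      simpa using (hid.mul_const b).const_add a
    have hm1 := half_add_mul_mem_slitPlane hs t
    have hm2 := half_add_mul_mem_slitPlane (s := -s) (by simpa using hs) t
    have d1 := (hP _ (hp t ht')).comp t (hlin (α / 2) β)
    have d2 := (hP _ (hq t ht')).comp t (hlin (-α / 2) β)
    have d3 := (hlin (1 / 2) s).clog_real hm1
    have d4 := (hlin (1 / 2) (-s)).clog_real hm2
    have d := ((d1.sub d2).add (d3.sub d4)).sub (hid.mul_const (η * β))
    refine d.congr_deriv ?_
    have n1 : 1 / 2 + t * s ≠ 0 := slitPlane_ne_zero hm1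
    have n2 : 1 / 2 + t * -s ≠ 0 := slitPlane_ne_zero hm2
    have e1 : s / (1 / 2 + t * s) = β * (1 / (α / 2 + t * β)) := by
      rw [hβ, show α / 2 + t * (s * α) = α * (1 / 2 + t * s) by ring]
      field_simp
    have e2 : -s / (1 / 2 + t * -s) = β * (1 / (-α / 2 + t * β)) := by
      rw [hβ, show -α / 2 + t * (s * α) = -(α * (1 / 2 + t * -s)) by ring]
      field_simp
    have h := hη t ht'
    rw [weierstrassZeta_eq, weierstrassZeta_eq] at h
    rw [e1, e2]
    linear_combination β * h
  have hconst := isOpen_Ioo.is_const_of_deriv_eq_zero isPreconnected_Ioo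
    (fun t ht ↦ (hg t ht).differentiableAt.differentiableWithinAt)
    (fun t ht ↦ (hg t ht).deriv) (x := (1 / 2 : ℝ)) (y := -(1 / 2 : ℝ)) (by norm_num) (by norm_num)
  simp only [g] at hconst
  push_cast at hconst
  have a1 : (1 / 2 : ℂ) + -(1 / 2) * s = 1 / 2 - 1 / 2 * s := by ring
  have a2 : (1 / 2 : ℂ) + -(1 / 2) * -s = 1 / 2 + 1 / 2 * s := by ring
  have a3 : (1 / 2 : ℂ) + 1 / 2 * -s = 1 / 2 - 1 / 2 * s := by ring
  have a4 : α / 2 + 1 / 2 * β = α / 2 + β / 2 := by ring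
  have a5 : -α / 2 + 1 / 2 * β = -α / 2 + β / 2 := by ring
  have a6 : α / 2 + -(1 / 2) * β = α / 2 - β / 2 := by ring
  have a7 : -α / 2 + -(1 / 2) * β = -α / 2 - β / 2 := by ring
  rw [a1, a2, a3, a4, a5, a6, a7] at hconst
  linear_combination -hconst

lemma real_combination_notMem_lattice (L : PeriodPair) {x y : ℝ}
    (hx : |x| < 1) (hy : |y| < 1) (h0 : x ≠ 0 ∨ y ≠ 0) :
    (x * L.ω₁ + y * L.ω₂ : ℂ) ∉ L.lattice := by
  intro h
  refine periodBox_subset_regularSet L ((real_combination_mem_periodBox L).mpr ⟨hx, hy⟩)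
    ⟨h, fun h' ↦ ?_⟩
  have := LinearIndependent.pair_iff.mp L.indep x y (by simpa using h')
  tauto

/-- **Legendre's relation**. -/
theorem legendre_eq (L : PeriodPair) (hL : 0 < (L.ω₂ / L.ω₁).im) :
    legendre L = 2 * Real.pi * I := by
  obtain ⟨P, hP⟩ := exists_primitive_zetaReg L
  have hω₁ : L.ω₁ ≠ 0 := by
    intro h
    simp [h] at hL
  have hω₂ : L.ω₂ ≠ 0 := by
    intro h
    simp [h] at hL
  have hinv : L.ω₁ / L.ω₂ = (L.ω₂ / L.ω₁)⁻¹ := (inv_div _ _).symm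
  have him : (L.ω₁ / L.ω₂).im ≠ 0 := by
    rw [hinv, inv_im]
    exact div_ne_zero (neg_ne_zero.mpr hL.ne') (normSq_pos.mpr (div_ne_zero hω₂ hω₁)).ne'
  have hhalf : |(1 / 2 : ℝ)| < 1 := by norm_num [abs_lt]
  have hhalf' : |(-(1 / 2) : ℝ)| < 1 := by norm_num [abs_lt]
  have c1 : ∀ t : ℝ, L.ω₁ / 2 + t * L.ω₂ = (1 / 2 : ℝ) * L.ω₁ + t * L.ω₂ := fun t ↦ by
    push_cast; ring
  have c2 : ∀ t : ℝ, -L.ω₁ / 2 + t * L.ω₂ = (-(1 / 2) : ℝ) * L.ω₁ + t * L.ω₂ := fun t ↦ by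
    push_cast; ring
  have c3 : ∀ t : ℝ, L.ω₂ / 2 + t * L.ω₁ = t * L.ω₁ + (1 / 2 : ℝ) * L.ω₂ := fun t ↦ by
    push_cast; ring
  have c4 : ∀ t : ℝ, -L.ω₂ / 2 + t * L.ω₁ = t * L.ω₁ + (-(1 / 2) : ℝ) * L.ω₂ := fun t ↦ by
    push_cast; ring
  have h1 := quasiperiod_mul_eq L hP (η := eta₁ L.ω₁ L.ω₂) hω₁ hL.ne'
    (fun t ht ↦ by rw [c1]; exact (real_combination_mem_periodBox L).mpr ⟨hhalf, ht⟩)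
    (fun t ht ↦ by rw [c2]; exact (real_combination_mem_periodBox L).mpr ⟨hhalf', ht⟩)
    (fun t ht ↦ by
      rw [← weierstrassZeta_add_period_one L]
      · congr 1; ring
      · rw [c2]
        exact real_combination_notMem_lattice L hhalf' ht (.inl (by norm_num)))
  have h2 := quasiperiod_mul_eq L hP (η := eta₂ L.ω₁ L.ω₂) hω₂ him
    (fun t ht ↦ by rw [c3]; exact (real_combination_mem_periodBox L).mpr ⟨ht, hhalf⟩)
    (fun t ht ↦ by rw [c4]; exact (real_combination_mem_periodBox L).mpr ⟨ht, hhalf'⟩)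
    (fun t ht ↦ by
      rw [← weierstrassZeta_add_period_two L]
      · congr 1; ring
      · rw [c4]
        exact real_combination_notMem_lattice L ht hhalf' (.inr (by norm_num)))
  have h3 := log_half_add_sub_log_half_sub hL
  rw [hinv] at h2
  have b1 : L.ω₂ / 2 + L.ω₁ / 2 = L.ω₁ / 2 + L.ω₂ / 2 := by ring
  have b2 : -L.ω₂ / 2 + L.ω₁ / 2 = L.ω₁ / 2 - L.ω₂ / 2 := by ring
  have b3 : L.ω₂ / 2 - L.ω₁ / 2 = -L.ω₁ / 2 + L.ω₂ / 2 := by ring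
  have b4 : -L.ω₂ / 2 - L.ω₁ / 2 = -L.ω₁ / 2 - L.ω₂ / 2 := by ring
  rw [b1, b2, b3, b4] at h2
  rw [legendre]
  -- The corner values of `P` agree for the two pairs of edges and cancel; only the logarithms
  -- survive.
  linear_combination h1 - h2 + 2 * h3

/-! ### Branches of `ln σ` and Euler's relation -/

/-- The derivative of a continuous logarithm. -/
lemma hasDerivAt_of_exp_eq {f g : ℂ → ℂ} {x S : ℂ} (hf : ContinuousAt f x)
    (h : ∀ᶠ t in 𝓝 x, exp (f t) = g t) (hg : HasDerivAt g (g x * S) x) : HasDerivAt f S x := by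
  have hgx : g x ≠ 0 := by
    rw [← h.self_of_nhds]
    exact exp_ne_zero _
  have hd : HasDerivAt (fun t ↦ g t / g x) S x :=
    (hg.div_const (g x)).congr_deriv (by field_simp)
  have hd' := (hd.clog (by rw [div_self hgx]; exact one_mem_slitPlane)).const_add (f x)
  rw [div_self hgx, div_one] at hd'
  refine hd'.congr_of_eventuallyEq ?_
  -- Continuity keeps the imaginary part of `f t - f x` within `(-π, π)`, so this difference is the
  -- principal logarithm of `g t / g x`.
  have hlim : Tendsto (fun t ↦ (f t - f x).im) (𝓝 x) (𝓝 0) := by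
    have := continuous_im.continuousAt.tendsto.comp (hf.tendsto.sub_const (f x))
    simpa [Function.comp_def] using this
  filter_upwards [h, hlim.eventually (Ioo_mem_nhds (neg_lt_zero.mpr Real.pi_pos) Real.pi_pos)]
    with t ht hI
  rw [← ht, ← h.self_of_nhds, ← exp_sub, log_exp hI.1 hI.2.le]
  ring

lemma exists_isLogSigmaBranch (L : PeriodPair) {z : ℂ} (hz : z ∉ L.lattice) :
    ∃ ℓ : ℂ × ℂ × ℂ → ℂ, IsLogSigmaBranch ℓ (z, L.ω₁, L.ω₂) := by
  have hσ := weierstrassSigma_ne_zero L hz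
  have hcont := eventually_continuousAt_weierstrassSigma L z
  have hslit : ∀ᶠ q : ℂ × ℂ × ℂ in 𝓝 (z, L.ω₁, L.ω₂),
      weierstrassSigma q.1 q.2.1 q.2.2 / weierstrassSigma z L.ω₁ L.ω₂ ∈ slitPlane := by
    refine (hcont.self_of_nhds.div_const _).eventually (isOpen_slitPlane.mem_nhds ?_)
    simp only
    rw [div_self hσ]
    exact one_mem_slitPlane
  -- Dividing by the value at the base point keeps the argument of `log` near 1, away from the cut.
  refine ⟨fun q ↦ log (weierstrassSigma z L.ω₁ L.ω₂) +
    log (weierstrassSigma q.1 q.2.1 q.2.2 / weierstrassSigma z L.ω₁ L.ω₂), ?_⟩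
  filter_upwards [hcont, hslit] with q hq hq'
  refine ⟨continuousAt_const.add ((hq.div_const _).clog hq'), ?_⟩
  rw [exp_add, exp_log hσ, exp_log (slitPlane_ne_zero hq'), mul_div_cancel₀ _ hσ]

lemma hasDerivAt_branch_line (L : PeriodPair) {z : ℂ} (hz : z ∉ L.lattice)
    {ℓ : ℂ × ℂ × ℂ → ℂ} (hℓ : IsLogSigmaBranch ℓ (z, L.ω₁, L.ω₂)) (v₁ v₂ : ℂ) :
    HasDerivAt (fun t : ℂ ↦ ℓ (z, L.ω₁ + t * v₁, L.ω₂ + t * v₂))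
      (∑' m : NonzeroPair,
        period v₁ v₂ m * z ^ 3 / (period L.ω₁ L.ω₂ m ^ 3 * (period L.ω₁ L.ω₂ m - z))) 0 := by
  let γ : ℂ → ℂ × ℂ × ℂ := fun t ↦ (z, L.ω₁ + t * v₁, L.ω₂ + t * v₂)
  have hγ : Continuous γ := by fun_prop
  have h0 : γ 0 = (z, L.ω₁, L.ω₂) := by simp [γ]
  have hγ0 : Tendsto γ (𝓝 0) (𝓝 (z, L.ω₁, L.ω₂)) := h0 ▸ hγ.tendsto 0
  have hc : ContinuousAt ℓ (γ 0) := h0 ▸ hℓ.self_of_nhds.1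
  refine hasDerivAt_of_exp_eq
    (g := fun t ↦ weierstrassSigma z (L.ω₁ + t * v₁) (L.ω₂ + t * v₂))
    (ContinuousAt.comp (f := γ) hc hγ.continuousAt)
    ((hγ0.eventually hℓ).mono fun t ht ↦ ht.2) ?_
  simpa using hasDerivAt_weierstrassSigma_line L hz v₁ v₂

/-- Euler's relation for the homogeneity of the sigma function. -/
lemma tsum_period_two (L : PeriodPair) {z : ℂ} (hz : z ∉ L.lattice) :
    L.ω₂ * ∑' m : NonzeroPair,
      period 0 1 m * z ^ 3 / (period L.ω₁ L.ω₂ m ^ 3 * (period L.ω₁ L.ω₂ m - z)) =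
    1 - z * weierstrassZeta z L.ω₁ L.ω₂ - L.ω₁ * periodSum L z := by
  have hz0 : z ≠ 0 := by
    rintro rfl
    exact hz (zero_mem _)
  rw [weierstrassZeta_eq, mul_add, mul_one_div_cancel hz0, eq_sub_iff_add_eq, periodSum,
    ← tsum_mul_left, ← tsum_mul_left, ← ((summable_period_mul L 0 1 z).mul_left _).tsum_add
    ((summable_period_mul L 1 0 z).mul_left _), zetaReg, ← tsum_mul_left, sub_add_cancel_left,
    ← tsum_neg]
  refine tsum_congr fun m ↦ ?_
  have h1 := period_ne_zero L m
  have h2 : period L.ω₁ L.ω₂ m - z ≠ 0 := sub_ne_zero.mpr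
    (ne_period_of_mem_regularSet (compl_lattice_subset_regularSet L hz) m).symm
  have h3 : L.ω₂ * period 0 1 m + L.ω₁ * period 1 0 m = period L.ω₁ L.ω₂ m := by
    simp [period]
    ring
  rw [← mul_div_assoc, ← mul_div_assoc, ← add_div, ← mul_assoc, ← mul_assoc, ← add_mul, h3,
    ← neg_sub _ z, div_neg]
  field_simp
  ring

end EllipticPeriods

theorem mainTheorem6 (L : PeriodPair) (hL : 0 < (L.ω₂ / L.ω₁).im) (z : ℂ) (hz : z ∉ L.lattice) :
    (∃ ℓ : ℂ × ℂ × ℂ → ℂ, EllipticPeriods.IsLogSigmaBranch ℓ (z, L.ω₁, L.ω₂)) ∧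
    ∀ ℓ : ℂ × ℂ × ℂ → ℂ, EllipticPeriods.IsLogSigmaBranch ℓ (z, L.ω₁, L.ω₂) →
      HasDerivAt (fun w : ℂ => ℓ (z, w, L.ω₂))
        (1 / (2 * (Real.pi : ℂ) * Complex.I) *
          (1 / 2 * L.ω₂ *
              (L.weierstrassP z - EllipticPeriods.weierstrassZeta z L.ω₁ L.ω₂ ^ 2)
            + EllipticPeriods.eta₂ L.ω₁ L.ω₂ *
              (z * EllipticPeriods.weierstrassZeta z L.ω₁ L.ω₂ - 1)
            - L.ω₂ * (L.g₂ / 24) * z ^ 2))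
        L.ω₁ ∧
      HasDerivAt (fun w : ℂ => ℓ (z, L.ω₁, w))
        (-(1 / (2 * (Real.pi : ℂ) * Complex.I)) *
          (1 / 2 * L.ω₁ *
              (L.weierstrassP z - EllipticPeriods.weierstrassZeta z L.ω₁ L.ω₂ ^ 2)
            + EllipticPeriods.eta₁ L.ω₁ L.ω₂ *
              (z * EllipticPeriods.weierstrassZeta z L.ω₁ L.ω₂ - 1)
            - L.ω₁ * (L.g₂ / 24) * z ^ 2))
        L.ω₂ := by
  refine ⟨EllipticPeriods.exists_isLogSigmaBranch L hz, fun ℓ hℓ ↦ ?_⟩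
  have hπ : 2 * (Real.pi : ℂ) * Complex.I ≠ 0 := Complex.two_pi_I_ne_zero
  have hκ := EllipticPeriods.legendre_eq L hL
  have hA := EllipticPeriods.legendre_mul_periodSum L hz
  have hB := EllipticPeriods.tsum_period_two L hz
  have hω₂ : L.ω₂ ≠ 0 := by
    intro h
    simp [h] at hL
  have h₁ := EllipticPeriods.hasDerivAt_branch_line L hz hℓ 1 0
  have h₂ := EllipticPeriods.hasDerivAt_branch_line L hz hℓ 0 1
  have shift : ∀ {f : ℂ → ℂ} {S : ℂ} (a : ℂ), HasDerivAt f S 0 →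
      HasDerivAt (fun w ↦ f (w - a)) S a := fun a h ↦
    HasDerivAt.comp_sub_const a a (by rwa [sub_self])
  have h₁' := shift L.ω₁ h₁
  have h₂' := shift L.ω₂ h₂
  simp only [mul_one, mul_zero, add_zero, add_sub_cancel] at h₁' h₂'
  rw [hκ, EllipticPeriods.periodForm] at hA
  constructor
  · refine h₁'.congr_deriv ?_
    rw [← hA, ← EllipticPeriods.periodSum]
    field_simp
  · refine h₂'.congr_deriv (mul_left_cancel₀ hω₂ ?_)
    rw [hB]
    rw [EllipticPeriods.legendre] at hκ
    rw [neg_mul, mul_neg, one_div_mul_eq_div, mul_div_assoc', ← neg_div, eq_div_iff hπ]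
    -- Replacing `2πi` by `η₁ ω₂ - η₂ ω₁` in Euler's relation cancels the terms in `η₂` and leaves
    -- `ω₂` as a common factor.
    linear_combination -L.ω₁ * hA -
      (1 - z * EllipticPeriods.weierstrassZeta z L.ω₁ L.ω₂) * hκ
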